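/- Let $k$ be a field and let $P$ be a $k$-linear additive category with split idempotents. Let $\mathrm{mod}\,P$ be the category of finitely presented contravariant functors $M$ from $P$ to $k$-vector spaces, i.e. those for which there is an exact sequence $\mathrm{Hom}_P(-,X)\to \mathrm{Hom}_P(-,Y)\to M\to 0$ with $X,Y\in P$ (if the morphism spaces of $P$ are finite-dimensional, these functors automatically take finite-dimensional values). It is an exact category whose conflations are the sequences $0\to L\to M\to N\to 0$ in $\mathrm{mod}\,P$ that are pointwise short exact. Suppose that $\mathrm{mod}\,P$ is a Frobenius category (enough projectives, enough injectives, and projectives and injectives coincide). Let $S$ be a $k$-linear auto-equivalence of $P$, extended along the Yoneda functor $P\to\mathrm{mod}\,P$, $X\mapsto \mathrm{Hom}_P(-,X)$, to an exact functor $\mathrm{mod}\,P\to\mathrm{mod}\,P$, again denoted $S$. Assume that there is an exact sequence of exact functors from $\mathrm{mod}\,P$ to $\mathrm{mod}\,P$ $$0\to \mathrm{Id}\to X^0\to X^1\to X^2\to S\to 0,$$ where $X^0,X^1,X^2$ take values in the full subcategory $\mathrm{proj}\,P$ of projective objects of $\mathrm{mod}\,P$ (the direct summands of representable functors, hence, as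 idempotents split, the representable functors up to isomorphism). Then $P$ has a structure of $k$-linear triangulated category (satisfying the octahedral axiom) with suspension functor $S$, in which, for each $M\in \mathrm{mod}\,P$, the standard triangle $X^0M\to X^1M\to X^2M\to SX^0M$ is distinguished. Here the last morphism is the composition $X^2M\to SM\to SX^0M$, and $\mathrm{proj}\,P$ is identified with $P$ by the Yoneda functor. -/

import Mathlib

open CategoryTheory CategoryTheory.Limits CategoryTheory.Pretriangulated

universe w v u

/-- A contravariant functor `M` from a `k`-linear category `P` to `k`-vector spaces is finitely
presented if there is an exact sequence `Hom(-, X) ⟶ Hom(-, Y) ⟶ M ⟶ 0`.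
(For additive `P`, finite direct sums of representables are representable.) -/
def finPres (k : Type w) [Field k] (P : Type u) [Category.{v} P] [Preadditive P] [Linear k P] :
    ObjectProperty (Pᵒᵖ ⥤ ModuleCat.{v} k) := fun M =>
  ∃ (X Y : P) (f : X ⟶ Y) (p : (linearYoneda k P).obj Y ⟶ M)
    (h : (linearYoneda k P).map f ≫ p = 0),
      (ShortComplex.mk ((linearYoneda k P).map f) p h).Exact ∧ Epi p

/-- `mod P`: the category of finitely presented contravariant functors from `P` to `k`-vector
spaces, a full subcategory of the category of all functors. If the morphism spaces of `P` are
finite-dimensional, all these functors take finite-dimensional values. -/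
abbrev ModCat (k : Type w) [Field k] (P : Type u) [Category.{v} P] [Preadditive P] [Linear k P] :
    Type (max u (v + 1) w) :=
  (finPres k P).FullSubcategory

/-- The inclusion of `mod P` into the category of all contravariant functors. -/
abbrev modIncl (k : Type w) [Field k] (P : Type u) [Category.{v} P] [Preadditive P] [Linear k P] :
    ModCat k P ⥤ (Pᵒᵖ ⥤ ModuleCat.{v} k) :=
  (finPres k P).ι

theorem finPres_linearYoneda (k : Type w) [Field k] (P : Type u) [Category.{v} P] [Preadditive P]
    [Linear k P] (X : P) : finPres k P ((linearYoneda k P).obj X) := by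
  have h0 : (linearYoneda k P).map (0 : X ⟶ X) = 0 := by
    ext Y f
    exact comp_zero
  refine ⟨X, X, 0, 𝟙 _, by rw [h0, zero_comp], ?_, inferInstance⟩
  rw [ShortComplex.exact_iff_mono _ h0]
  infer_instance

/-- The Yoneda functor `X ↦ Hom(-, X)` from `P` to `mod P`. -/
def modYoneda (k : Type w) [Field k] (P : Type u) [Category.{v} P] [Preadditive P] [Linear k P] :
    P ⥤ ModCat k P :=
  (finPres k P).lift (linearYoneda k P) (finPres_linearYoneda k P)

/-- The conflations of the exact category `mod P`: the sequences `0 ⟶ L ⟶ M ⟶ N ⟶ 0` in `mod P`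
that are short exact as sequences of functors. -/
def modConflation (k : Type w) [Field k] (P : Type u) [Category.{v} P] [Preadditive P]
    [Linear k P] : ObjectProperty (ShortComplex (ModCat k P)) := fun T =>
  (T.map (modIncl k P)).ShortExact

/-- `M` is projective for the class `E` of conflations: morphisms out of `M` lift along
deflations. -/
def IsProjFor {A : Type u} [Category.{v} A] [Preadditive A] (E : ObjectProperty (ShortComplex A))
    (M : A) : Prop :=
  ∀ T : ShortComplex A, E T → ∀ f : M ⟶ T.X₃, ∃ g : M ⟶ T.X₂, g ≫ T.g = f

/-- `M` is injective for the class `E` of conflations: morphisms into `M` extend along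
inflations. -/
def IsInjFor {A : Type u} [Category.{v} A] [Preadditive A] (E : ObjectProperty (ShortComplex A))
    (M : A) : Prop :=
  ∀ T : ShortComplex A, E T → ∀ f : T.X₁ ⟶ M, ∃ g : T.X₂ ⟶ M, T.f ≫ g = f

/-- The Frobenius property of an exact category with class of conflations `E`: there are enough
projectives and enough injectives, and the projectives coincide with the injectives. -/
structure IsFrobenius {A : Type u} [Category.{v} A] [Preadditive A]
    (E : ObjectProperty (ShortComplex A)) : Prop where
  enough_proj : ∀ M : A, ∃ (K Q : A) (i : K ⟶ Q) (p : Q ⟶ M) (h : i ≫ p = 0),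
    E (ShortComplex.mk i p h) ∧ IsProjFor E Q
  enough_inj : ∀ M : A, ∃ (I C : A) (i : M ⟶ I) (p : I ⟶ C) (h : i ≫ p = 0),
    E (ShortComplex.mk i p h) ∧ IsInjFor E I
  proj_iff_inj : ∀ M : A, IsProjFor E M ↔ IsInjFor E M

/-- A functor `mod P ⥤ mod P` is exact if it is additive and preserves conflations. -/
def IsExactFunctor (k : Type w) [Field k] (P : Type u) [Category.{v} P] [Preadditive P]
    [Linear k P] (F : ModCat k P ⥤ ModCat k P) : Prop :=
  ∃ _ : F.Additive, ∀ T, modConflation k P T → modConflation k P (T.map F)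

/-- The sequence `L ⟶ M ⟶ N` in `mod P` is exact at `M`, as a sequence of functors. -/
def ModExactAt (k : Type w) [Field k] (P : Type u) [Category.{v} P] [Preadditive P] [Linear k P]
    {L M N : ModCat k P} (f : L ⟶ M) (g : M ⟶ N) : Prop :=
  ∃ h : f ≫ g = 0, ((ShortComplex.mk f g h).map (modIncl k P)).Exact

/-- The sequence `0 ⟶ M ⟶ X⁰ ⟶ X¹ ⟶ X² ⟶ N ⟶ 0` in `mod P` is exact, as a sequence of
functors. -/
structure IsExactSeq (k : Type w) [Field k] (P : Type u) [Category.{v} P] [Preadditive P]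
    [Linear k P] {M X₀ X₁ X₂ N : ModCat k P} (a : M ⟶ X₀) (d₀ : X₀ ⟶ X₁) (d₁ : X₁ ⟶ X₂)
    (b : X₂ ⟶ N) : Prop where
  mono : Mono ((modIncl k P).map a)
  exact₀ : ModExactAt k P a d₀
  exact₁ : ModExactAt k P d₀ d₁
  exact₂ : ModExactAt k P d₁ b
  epi : Epi ((modIncl k P).map b)

/-! ### Lifting tests against projectives and injectives -/

section Lifting

variable {A : Type u} [Category.{v} A]

/-! Once `mod P` is known to be abelian, `P` is its category of projective-injective objects, and a
morphism f : X ⟶ Y of `P` acquires a kernel M. Completing f to a triangle means choosing an exact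
sequence 0 ⟶ M ⟶ X ⟶ Y ⟶ Z ⟶ SM ⟶ 0 that represents the same class in Ext³(SM, M) as the given
functorial sequence at M. This is expressed by a ladder to the resolution of M which is the identity
at both ends (`StdTriangle`).

Morphisms: since the terms are injective, a square induces a map m of kernels, and the two resulting
ladders differ by a homotopy (`exists_comparison`). The functorial resolution then yields rotation
and the octahedron by one device. If p is the cokernel of m, then Xᵢ(m) ≫ Xᵢ(p) = 0, so composing
the homotopy with Xᵢ(p) leaves a ladder from the rotated or cone sequence to the resolution of the
cokernel. Rotation takes m to be the inclusion M ⟶ X (`nonempty_rotate`), and the cone takes m : ker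
f ⟶ ker (f ≫ v) (`exists_cone`). The octahedron is two cones followed by the removal of a
contractible summand.

Existence of Z (`exists_of_injective`): up to injective summands, coker f agrees with the image C of
d₁ at M, so the extension of SM by C given by X₂M comes from one by coker f.

Two preparations remain. `mod P` is abelian as soon as `P` has weak kernels, which are extracted
from the Frobenius property by a Schanuel-type argument (`exists_weakKernel`). A coherent action of
ℤ on `P` with generator S is obtained by replacing `P` with sequences of objects on which the shift
is reindexing (`OrbitSequence`). -/

theorem exists_lift_of_epi {X Y Q : A} [Projective Q] (f : X ⟶ Y) [Epi f] (x : Q ⟶ Y) :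
    ∃ x' : Q ⟶ X, x' ≫ f = x :=
  ⟨Projective.factorThru x f, Projective.factorThru_comp x f⟩

theorem exists_extension_of_mono {X Y J : A} [Injective J] (f : X ⟶ Y) [Mono f] (x : X ⟶ J) :
    ∃ x' : Y ⟶ J, f ≫ x' = x :=
  ⟨Injective.factorThru x f, Injective.comp_factorThru x f⟩

theorem Injective.of_section_retraction {I E : A} [Injective E] (s : I ⟶ E) (r : E ⟶ I)
    (h : s ≫ r = 𝟙 I) : Injective I where
  factors g f _ := ⟨Injective.factorThru (g ≫ s) f ≫ r, by simp [h]⟩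

theorem epi_of_projective [EnoughProjectives A] {X Y : A} {f : X ⟶ Y}
    (h : ∀ (Q : A) [Projective Q] (x : Q ⟶ Y), ∃ x' : Q ⟶ X, x' ≫ f = x) : Epi f := by
  obtain ⟨x', hx'⟩ := h _ (Projective.π Y)
  have : Epi (x' ≫ f) := by rw [hx']; infer_instance
  exact epi_of_epi x' f

end Lifting

section ProjectiveTests

variable {A : Type u} [Category.{v} A] [Abelian A]

theorem ShortComplex.Exact.lift_projective {X Y Z : A} {f : X ⟶ Y} {g : Y ⟶ Z} {w : f ≫ g = 0}
    (h : (ShortComplex.mk f g w).Exact) {Q : A} [Projective Q] (x : Q ⟶ Y) (hx : x ≫ g = 0) :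
    ∃ x' : Q ⟶ X, x' ≫ f = x :=
  ⟨h.liftFromProjective x hx, h.liftFromProjective_comp x hx⟩

theorem ShortComplex.Exact.desc_injective {X Y Z : A} {f : X ⟶ Y} {g : Y ⟶ Z} {w : f ≫ g = 0}
    (h : (ShortComplex.mk f g w).Exact) {J : A} [Injective J] (x : Y ⟶ J) (hx : f ≫ x = 0) :
    ∃ x' : Z ⟶ J, g ≫ x' = x :=
  ⟨h.descToInjective x hx, h.comp_descToInjective x hx⟩

theorem ShortComplex.Exact.of_iso {X Y Z X' Y' Z' : A} {f : X ⟶ Y} {g : Y ⟶ Z} {w : f ≫ g = 0}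
    (h : (ShortComplex.mk f g w).Exact) {f' : X' ⟶ Y'} {g' : Y' ⟶ Z'} (w' : f' ≫ g' = 0)
    (a : X ≅ X') (b : Y ≅ Y') (c : Z ≅ Z') (hf : a.hom ≫ f' = f ≫ b.hom)
    (hg : b.hom ≫ g' = g ≫ c.hom) : (ShortComplex.mk f' g' w').Exact :=
  ShortComplex.exact_of_iso (ShortComplex.isoMk a b c hf hg) h

/-- A monomorphism from an injective object splits, so its cokernel is a direct summand of E. -/
theorem injective_cokernel {X E Q : A} [Injective X] [Injective E] (f : X ⟶ E) [Mono f]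
    (p : E ⟶ Q) [Epi p] (w : f ≫ p = 0) (h : (ShortComplex.mk f p w).Exact) : Injective Q := by
  obtain ⟨r, hr⟩ := exists_extension_of_mono f (𝟙 X)
  obtain ⟨s, hs⟩ : ∃ s : Q ⟶ E, p ≫ s = 𝟙 E - r ≫ f :=
    ⟨h.desc (𝟙 E - r ≫ f) (by simp [reassoc_of% hr]), h.g_desc _ _⟩
  refine Injective.of_section_retraction s p ?_
  rw [← cancel_epi p, reassoc_of% hs]
  simp [w]

variable [EnoughProjectives A]

theorem exact_of_lift_projective {X Y Z : A} {f : X ⟶ Y} {g : Y ⟶ Z} (w : f ≫ g = 0)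
    (h : ∀ (Q : A) [Projective Q] (x : Q ⟶ Y), x ≫ g = 0 → ∃ x' : Q ⟶ X, x' ≫ f = x) :
    (ShortComplex.mk f g w).Exact := by
  rw [ShortComplex.exact_iff_exact_up_to_refinements]
  intro Q x hx
  obtain ⟨x', hx'⟩ := h (Projective.over Q) (Projective.π Q ≫ x) (by
    dsimp at hx
    simp [hx])
  exact ⟨_, Projective.π Q, inferInstance, x', hx'.symm⟩

theorem mono_of_projective {X Y : A} {f : X ⟶ Y}
    (h : ∀ (Q : A) [Projective Q] (x : Q ⟶ X), x ≫ f = 0 → x = 0) : Mono f :=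
  Preadditive.mono_of_cancel_zero _ fun {Q} x hx => by
    rw [← cancel_epi (Projective.π Q), h _ (Projective.π Q ≫ x) (by simp [hx]), comp_zero]

end ProjectiveTests

/-! ### Resolutions and standard triangles -/

/-- A functorial exact sequence `0 ⟶ Id ⟶ X₀ ⟶ X₁ ⟶ X₂ ⟶ T ⟶ 0` of additive endofunctors of an
abelian category, in which the `Xᵢ` take values in objects that are projective and injective. -/
structure PeriodicResolution {A : Type u} [Category.{v} A] [Abelian A] (T : A ⥤ A) where
  (X₀ X₁ X₂ : A ⥤ A)
  [additive₀ : X₀.Additive]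
  [additive₁ : X₁.Additive]
  [additive₂ : X₂.Additive]
  (α (M : A) : M ⟶ X₀.obj M)
  (d₀ : X₀ ⟶ X₁)
  (d₁ : X₁ ⟶ X₂)
  (β : X₂ ⟶ T)
  α_natural {M N : A} (f : M ⟶ N) : f ≫ α N = α M ≫ X₀.map f
  [mono (M : A) : Mono (α M)]
  [epi (M : A) : Epi (β.app M)]
  zero₀ (M : A) : α M ≫ d₀.app M = 0
  zero₁ (M : A) : d₀.app M ≫ d₁.app M = 0
  zero₂ (M : A) : d₁.app M ≫ β.app M = 0
  exact₀ (M : A) : (ShortComplex.mk _ _ (zero₀ M)).Exact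
  exact₁ (M : A) : (ShortComplex.mk _ _ (zero₁ M)).Exact
  exact₂ (M : A) : (ShortComplex.mk _ _ (zero₂ M)).Exact
  [projective₀ (M : A) : Projective (X₀.obj M)]
  [projective₁ (M : A) : Projective (X₁.obj M)]
  [projective₂ (M : A) : Projective (X₂.obj M)]
  [injective₀ (M : A) : Injective (X₀.obj M)]
  [injective₁ (M : A) : Injective (X₁.obj M)]
  [injective₂ (M : A) : Injective (X₂.obj M)]

namespace PeriodicResolution

attribute [instance] additive₀ additive₁ additive₂ mono epi projective₀ projective₁ projective₂
  injective₀ injective₁ injective₂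

variable {A : Type u} [Category.{v} A] [Abelian A] {T : A ⥤ A} (R : PeriodicResolution T)

attribute [simp] zero₀ zero₁ zero₂

/-- A triangle `X ⟶ Y ⟶ Z ⟶ T X` is standard if it comes from an exact sequence
`0 ⟶ M ⟶ X ⟶ Y ⟶ Z ⟶ T M ⟶ 0` that maps to the resolution of `M` by a morphism
which is the identity on `M` and on `T M`. -/
structure StdTriangle {X Y Z : A} (f : X ⟶ Y) (g : Y ⟶ Z) (h : Z ⟶ T.obj X) where
  (M : A)
  (i : M ⟶ X)
  (q : Z ⟶ T.obj M)
  [mono_i : Mono i]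
  [epi_q : Epi q]
  if_zero : i ≫ f = 0
  fg_zero : f ≫ g = 0
  gq_zero : g ≫ q = 0
  exact_if : (ShortComplex.mk _ _ if_zero).Exact
  exact_fg : (ShortComplex.mk _ _ fg_zero).Exact
  exact_gq : (ShortComplex.mk _ _ gq_zero).Exact
  q_map_i : q ≫ T.map i = h
  (φ₀ : X ⟶ R.X₀.obj M)
  (φ₁ : Y ⟶ R.X₁.obj M)
  (φ₂ : Z ⟶ R.X₂.obj M)
  i_φ₀ : i ≫ φ₀ = R.α M
  f_φ₁ : f ≫ φ₁ = φ₀ ≫ R.d₀.app M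
  g_φ₂ : g ≫ φ₂ = φ₁ ≫ R.d₁.app M
  φ₂_β : φ₂ ≫ R.β.app M = q

namespace StdTriangle

attribute [instance] mono_i epi_q
attribute [simp] if_zero fg_zero gq_zero

variable {R}

section

variable {X Y Z : A} {f : X ⟶ Y} {g : Y ⟶ Z} {h : Z ⟶ T.obj X}

theorem fg_zero_assoc (D : R.StdTriangle f g h) {W : A} (x : Z ⟶ W) : f ≫ g ≫ x = 0 := by
  rw [reassoc_of% D.fg_zero, zero_comp]

section

variable (D : R.StdTriangle f g h) {W : A}

@[simp]
theorem if_zero_assoc (x : Y ⟶ W) : D.i ≫ f ≫ x = 0 := by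
  rw [reassoc_of% D.if_zero, zero_comp]

@[simp]
theorem gq_zero_assoc (x : T.obj D.M ⟶ W) : g ≫ D.q ≫ x = 0 := by
  rw [reassoc_of% D.gq_zero, zero_comp]

theorem q_map_i_assoc (x : T.obj X ⟶ W) : D.q ≫ T.map D.i ≫ x = h ≫ x := by
  rw [← Category.assoc]
  exact D.q_map_i =≫ x

theorem i_φ₀_assoc (x : R.X₀.obj D.M ⟶ W) : D.i ≫ D.φ₀ ≫ x = R.α D.M ≫ x := by
  rw [reassoc_of% D.i_φ₀]

theorem f_φ₁_assoc (x : R.X₁.obj D.M ⟶ W) : f ≫ D.φ₁ ≫ x = D.φ₀ ≫ R.d₀.app D.M ≫ x := by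
  rw [reassoc_of% D.f_φ₁]

theorem g_φ₂_assoc (x : R.X₂.obj D.M ⟶ W) : g ≫ D.φ₂ ≫ x = D.φ₁ ≫ R.d₁.app D.M ≫ x := by
  rw [reassoc_of% D.g_φ₂]

theorem φ₂_β_assoc (x : T.obj D.M ⟶ W) : D.φ₂ ≫ R.β.app D.M ≫ x = D.q ≫ x := by
  rw [reassoc_of% D.φ₂_β]

end

theorem g_h (D : R.StdTriangle f g h) : g ≫ h = 0 := by
  rw [← D.q_map_i, D.gq_zero_assoc]

theorem h_map_f [T.Additive] (D : R.StdTriangle f g h) : h ≫ T.map f = 0 := by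
  rw [← D.q_map_i, Category.assoc, ← T.map_comp, D.if_zero, T.map_zero, comp_zero]

/-- A triangle mapping to a standard triangle, compatibly with the outer terms of the exact
sequence, is standard. -/
def precomp {X' Y' Z' : A} {f' : X' ⟶ Y'} {g' : Y' ⟶ Z'} {h' : Z' ⟶ T.obj X'}
    (D : R.StdTriangle f g h) (i : D.M ⟶ X') (q : Z' ⟶ T.obj D.M) [Mono i] [Epi q]
    (w₁ : i ≫ f' = 0) (w₂ : f' ≫ g' = 0) (w₃ : g' ≫ q = 0)
    (e₁ : (ShortComplex.mk _ _ w₁).Exact) (e₂ : (ShortComplex.mk _ _ w₂).Exact)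
    (e₃ : (ShortComplex.mk _ _ w₃).Exact) (hq : q ≫ T.map i = h')
    (a : X' ⟶ X) (b : Y' ⟶ Y) (c : Z' ⟶ Z) (hi : i ≫ a = D.i) (hab : f' ≫ b = a ≫ f)
    (hbc : g' ≫ c = b ≫ g) (hc : c ≫ D.q = q) : R.StdTriangle f' g' h' where
  M := D.M
  i := i
  q := q
  if_zero := w₁
  fg_zero := w₂
  gq_zero := w₃
  exact_if := e₁
  exact_fg := e₂
  exact_gq := e₃
  q_map_i := hq
  φ₀ := a ≫ D.φ₀
  φ₁ := b ≫ D.φ₁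
  φ₂ := c ≫ D.φ₂
  i_φ₀ := by rw [reassoc_of% hi, D.i_φ₀]
  f_φ₁ := by rw [reassoc_of% hab, D.f_φ₁, Category.assoc]
  g_φ₂ := by rw [reassoc_of% hbc, D.g_φ₂, Category.assoc]
  φ₂_β := by rw [Category.assoc, D.φ₂_β, hc]

/-- Standard triangles are stable under isomorphism. -/
def ofIso {X' Y' Z' : A} {f' : X' ⟶ Y'} {g' : Y' ⟶ Z'} {h' : Z' ⟶ T.obj X'}
    (D : R.StdTriangle f g h) (a : X' ≅ X) (b : Y' ≅ Y) (c : Z' ≅ Z)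
    (hab : f' ≫ b.hom = a.hom ≫ f) (hbc : g' ≫ c.hom = b.hom ≫ g)
    (hca : h' ≫ T.map a.hom = c.hom ≫ h) : R.StdTriangle f' g' h' :=
  have hf : f' = a.hom ≫ f ≫ b.inv := by simp [← reassoc_of% hab]
  have hg : g' = b.hom ≫ g ≫ c.inv := by simp [← reassoc_of% hbc]
  D.precomp (D.i ≫ a.inv) (c.hom ≫ D.q) (by simp [hf]) (by simp [hf, hg, D.fg_zero_assoc])
    (by simp [hg])
    (ShortComplex.Exact.of_iso D.exact_if _ (Iso.refl _) a.symm b.symm (by simp) (by simp [hf]))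
    (ShortComplex.Exact.of_iso D.exact_fg _ a.symm b.symm c.symm (by simp [hf]) (by simp [hg]))
    (ShortComplex.Exact.of_iso D.exact_gq _ b.symm c.symm (Iso.refl _) (by simp [hg]) (by simp))
    (by
      rw [T.map_comp, Category.assoc, D.q_map_i_assoc, ← reassoc_of% hca, ← T.map_comp,
        a.hom_inv_id, T.map_id, Category.comp_id])
    a.hom b.hom c.hom (by simp) hab hbc rfl

/-- The triangle `X₀ M ⟶ X₁ M ⟶ X₂ M ⟶ T (X₀ M)`. -/
def resolution (M : A) : R.StdTriangle (R.d₀.app M) (R.d₁.app M)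
    (R.β.app M ≫ T.map (R.α M)) where
  M := M
  i := R.α M
  q := R.β.app M
  if_zero := R.zero₀ M
  fg_zero := R.zero₁ M
  gq_zero := R.zero₂ M
  exact_if := R.exact₀ M
  exact_fg := R.exact₁ M
  exact_gq := R.exact₂ M
  q_map_i := rfl
  φ₀ := 𝟙 _
  φ₁ := 𝟙 _
  φ₂ := 𝟙 _
  i_φ₀ := by simp
  f_φ₁ := by simp
  g_φ₂ := by simp
  φ₂_β := by simp

/-- The triangle `X ⟶ X ⟶ 0 ⟶ T X`. -/
theorem nonempty_contractible [T.Additive] {X Z : A} (hZ : IsZero Z) (g : X ⟶ Z)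
    (h : Z ⟶ T.obj X) : Nonempty (R.StdTriangle (𝟙 X) g h) := by
  obtain ⟨O, h0⟩ := HasZeroObject.zero (C := A)
  have hT : IsZero (T.obj O) := T.map_isZero h0
  obtain rfl : g = 0 := hZ.eq_of_tgt _ _
  have : Mono (0 : O ⟶ X) := ⟨fun _ _ _ => h0.eq_of_tgt _ _⟩
  have : Epi (0 : Z ⟶ T.obj O) := ⟨fun _ _ _ => hT.eq_of_src _ _⟩
  exact ⟨{ M := O, i := 0, q := 0, φ₀ := 0, φ₁ := 0, φ₂ := 0
           if_zero := by simp
           fg_zero := by simp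
           gq_zero := by simp
           exact_if := (ShortComplex.exact_iff_mono _ rfl).2 (by dsimp; infer_instance)
           exact_fg := (ShortComplex.exact_iff_epi _ rfl).2 (by dsimp; infer_instance)
           exact_gq := ShortComplex.exact_of_isZero_X₂ _ hZ
           q_map_i := hZ.eq_of_src _ _
           i_φ₀ := h0.eq_of_src _ _
           f_φ₁ := by simp
           g_φ₂ := by simp
           φ₂_β := by simp }⟩

end

/-! ### Morphisms of standard triangles up to homotopy -/

section Comparison

variable {X Y Z X' Y' Z' : A} {f : X ⟶ Y} {g : Y ⟶ Z} {h : Z ⟶ T.obj X}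
  {f' : X' ⟶ Y'} {g' : Y' ⟶ Z'} {h' : Z' ⟶ T.obj X'}

/-- A commutative square between standard triangles extends to a morphism which commutes with
the ladders to the resolutions up to a homotopy whose last component factors through `σ`. -/
theorem exists_comparison (D : R.StdTriangle f g h) (D' : R.StdTriangle f' g' h') [Injective Z']
    (a : X ⟶ X') (b : Y ⟶ Y') (hab : f ≫ b = a ≫ f') :
    ∃ (m : D.M ⟶ D'.M) (c : Z ⟶ Z') (s₁ : Y ⟶ R.X₀.obj D'.M) (s₂ : Z ⟶ R.X₁.obj D'.M)
      (s₃ : T.obj D.M ⟶ R.X₂.obj D'.M) (σ : R.X₂.obj D'.M ⟶ R.X₂.obj D'.M),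
      m ≫ D'.i = D.i ≫ a ∧ g ≫ c = b ≫ g' ∧ c ≫ D'.q = D.q ≫ T.map m ∧
      σ ≫ R.β.app D'.M = 0 ∧
      a ≫ D'.φ₀ = D.φ₀ ≫ R.X₀.map m + f ≫ s₁ ∧
      b ≫ D'.φ₁ = D.φ₁ ≫ R.X₁.map m + g ≫ s₂ + s₁ ≫ R.d₀.app D'.M ∧
      c ≫ D'.φ₂ = D.φ₂ ≫ R.X₂.map m + D.q ≫ s₃ ≫ σ + s₂ ≫ R.d₁.app D'.M := by
  obtain ⟨m, hm⟩ : ∃ m : D.M ⟶ D'.M, m ≫ D'.i = D.i ≫ a :=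
    ⟨D'.exact_if.lift (D.i ≫ a) (by simp [← hab]), D'.exact_if.lift_f _ _⟩
  have n₀ : R.X₀.map m ≫ R.d₀.app _ = R.d₀.app _ ≫ R.X₁.map m := R.d₀.naturality m
  have n₁ : R.X₁.map m ≫ R.d₁.app _ = R.d₁.app _ ≫ R.X₂.map m := R.d₁.naturality m
  have n₂ : R.X₂.map m ≫ R.β.app _ = R.β.app _ ≫ T.map m := R.β.naturality m
  obtain ⟨s₁, hs₁⟩ := ShortComplex.Exact.desc_injective D.exact_if
    (a ≫ D'.φ₀ - D.φ₀ ≫ R.X₀.map m) (by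
      rw [Preadditive.comp_sub, ← reassoc_of% hm, D'.i_φ₀, D.i_φ₀_assoc, R.α_natural, sub_self])
  obtain ⟨s₂, hs₂⟩ := ShortComplex.Exact.desc_injective D.exact_fg
    (b ≫ D'.φ₁ - D.φ₁ ≫ R.X₁.map m - s₁ ≫ R.d₀.app _) (by
      rw [Preadditive.comp_sub, Preadditive.comp_sub, reassoc_of% hab, D'.f_φ₁, D.f_φ₁_assoc,
        reassoc_of% hs₁]
      simp [n₀])
  obtain ⟨c₀, hc₀⟩ := ShortComplex.Exact.desc_injective D.exact_fg (b ≫ g') (by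
    rw [reassoc_of% hab, D'.fg_zero, comp_zero])
  obtain ⟨s₃, hs₃⟩ := ShortComplex.Exact.desc_injective D.exact_gq
    (c₀ ≫ D'.φ₂ - D.φ₂ ≫ R.X₂.map m - s₂ ≫ R.d₁.app _) (by
      rw [Preadditive.comp_sub, Preadditive.comp_sub, reassoc_of% hc₀, D'.g_φ₂, D.g_φ₂_assoc,
        reassoc_of% hs₂]
      simp [n₁])
  -- The extension c₀ need not induce `T.map m` on the last terms; `s₃` measures the failure.
  -- Subtracting `D.q ≫ s₃ ≫ t` repairs it, because t lies over `T.obj D'.M`. What remains of `s₃`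
  -- is composed with σ = 1 - t ≫ φ₂, which β kills.
  obtain ⟨t, ht⟩ := exists_lift_of_epi D'.q (R.β.app D'.M)
  have hσ : (𝟙 _ - t ≫ D'.φ₂) ≫ R.β.app D'.M = 0 := by
    simp [D'.φ₂_β, ht]
  have hc : (c₀ - D.q ≫ s₃ ≫ t) ≫ D'.φ₂ = D.φ₂ ≫ R.X₂.map m +
      D.q ≫ s₃ ≫ (𝟙 _ - t ≫ D'.φ₂) + s₂ ≫ R.d₁.app D'.M := by
    simp only [Preadditive.comp_sub, Preadditive.sub_comp, Category.assoc, Category.comp_id, hs₃]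
    abel
  refine ⟨m, c₀ - D.q ≫ s₃ ≫ t, s₁, s₂, s₃, 𝟙 _ - t ≫ D'.φ₂, hm, by simp [hc₀], ?_, hσ,
    by rw [hs₁]; abel, by rw [hs₂]; abel, hc⟩
  rw [← D'.φ₂_β, reassoc_of% hc]
  simp only [Preadditive.add_comp, Category.assoc, hσ, n₂, D.φ₂_β_assoc]
  simp

theorem exists_completion (D : R.StdTriangle f g h) (D' : R.StdTriangle f' g' h') [Injective Z']
    (a : X ⟶ X') (b : Y ⟶ Y') (hab : f ≫ b = a ≫ f') :
    ∃ c : Z ⟶ Z', g ≫ c = b ≫ g' ∧ h ≫ T.map a = c ≫ h' := by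
  obtain ⟨m, c, -, -, -, -, hm, hc, hq, -⟩ := D.exists_comparison D' a b hab
  refine ⟨c, hc, ?_⟩
  have hh := D.q_map_i =≫ T.map a
  rw [← D'.q_map_i, reassoc_of% hq, ← hh, Category.assoc, ← T.map_comp, ← T.map_comp, hm]

end Comparison

end StdTriangle

end PeriodicResolution

namespace PeriodicResolution

variable {A : Type u} [Category.{v} A] [Abelian A] {T : A ⥤ A} {R : PeriodicResolution T}

namespace StdTriangle

/-! ### Long exact sequence and rotation -/

section Rotation

variable {X Y Z : A} {f : X ⟶ Y} {g : Y ⟶ Z} {h : Z ⟶ T.obj X}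

/-- As T is left exact, `T.map D.i` is mono, so h = q ≫ T(i) has the same kernel as q. -/
theorem exact_gh [T.Additive] [PreservesFiniteLimits T] (D : R.StdTriangle f g h) :
    (ShortComplex.mk _ _ D.g_h).Exact := by
  have e := (ShortComplex.exact_iff_of_epi_of_isIso_of_mono
    (ShortComplex.Hom.mk (S₁ := ShortComplex.mk _ _ D.gq_zero) (S₂ := ShortComplex.mk _ _ D.g_h)
      (𝟙 _) (𝟙 _) (T.map D.i) (by simp) (by simp [D.q_map_i]))).1 D.exact_gq
  exact e

variable [EnoughProjectives A]

/-- Since q is epi, the image of h is that of T(i), which is ker T(f) by exactness of T. -/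
theorem exact_h_map_f [T.Additive] [PreservesFiniteLimits T] [PreservesFiniteColimits T]
    (D : R.StdTriangle f g h) : (ShortComplex.mk _ _ D.h_map_f).Exact := by
  refine exact_of_lift_projective _ fun Q _ x hx => ?_
  obtain ⟨y, hy⟩ := ShortComplex.Exact.lift_projective (D.exact_if.map T) x hx
  obtain ⟨z, hz⟩ := exists_lift_of_epi D.q y
  refine ⟨z, ?_⟩
  dsimp at hy
  have hh := D.q_map_i
  rw [← hy, ← hz, Category.assoc, hh]

/-- The rotated triangle belongs to L = coker i, the image of f. The maps φ composed with Xᵢ(i) and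
the map α at X form a ladder up to a homotopy s₁, s₂, s₃; composed with Xᵢ(π), where Xᵢ(i) ≫ Xᵢ(π) =
0, the homotopy itself becomes the ladder for L. Its alternating signs produce the sign in -T(f). -/
theorem nonempty_rotate [T.Additive] [PreservesFiniteLimits T] [PreservesFiniteColimits T]
    [Projective (T.obj X)] (D : R.StdTriangle f g h) :
    Nonempty (R.StdTriangle g h (-T.map f)) := by
  let L := cokernel D.i
  let π : X ⟶ L := cokernel.π D.i
  have hπ : D.i ≫ π = 0 := cokernel.condition D.i
  have eπ : (ShortComplex.mk _ _ hπ).Exact :=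
    ShortComplex.exact_of_g_is_cokernel _ (cokernelIsCokernel D.i)
  let j : L ⟶ Y := cokernel.desc D.i f D.if_zero
  have hj : π ≫ j = f := cokernel.π_desc _ _ _
  have hjg : j ≫ g = 0 := by
    rw [← cancel_epi π, reassoc_of% hj, D.fg_zero, comp_zero]
  have : Mono j := mono_of_projective fun Q _ x hx => by
    obtain ⟨y, rfl⟩ := exists_lift_of_epi π x
    rw [Category.assoc, hj] at hx
    obtain ⟨z, rfl⟩ := ShortComplex.Exact.lift_projective D.exact_if y hx
    rw [Category.assoc, hπ, comp_zero]
  have : Epi (-T.map π) := by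
    have : -T.map π = (-𝟙 (T.obj X)) ≫ T.map π := by simp
    rw [this]
    have : IsIso (-𝟙 (T.obj X)) := ⟨-𝟙 _, by simp, by simp⟩
    infer_instance
  have hh := D.q_map_i
  have hhπ : h ≫ (-T.map π) = 0 := by
    rw [← hh, Preadditive.comp_neg, Category.assoc, ← T.map_comp, hπ, T.map_zero, comp_zero,
      neg_zero]
  have n₀ : R.X₀.map π ≫ R.d₀.app _ = R.d₀.app _ ≫ R.X₁.map π := R.d₀.naturality π
  have n₁ : R.X₁.map π ≫ R.d₁.app _ = R.d₁.app _ ≫ R.X₂.map π := R.d₁.naturality π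
  have n₂ : R.X₂.map π ≫ R.β.app _ = R.β.app _ ≫ T.map π := R.β.naturality π
  have k₀ : R.X₀.map D.i ≫ R.d₀.app _ = R.d₀.app _ ≫ R.X₁.map D.i := R.d₀.naturality _
  have k₁ : R.X₁.map D.i ≫ R.d₁.app _ = R.d₁.app _ ≫ R.X₂.map D.i := R.d₁.naturality _
  have k₂ : R.X₂.map D.i ≫ R.β.app _ = R.β.app _ ≫ T.map D.i := R.β.naturality _
  have c₀ : R.X₀.map D.i ≫ R.X₀.map π = 0 := by rw [← Functor.map_comp, hπ, Functor.map_zero]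
  have c₁ : R.X₁.map D.i ≫ R.X₁.map π = 0 := by rw [← Functor.map_comp, hπ, Functor.map_zero]
  have c₂ : R.X₂.map D.i ≫ R.X₂.map π = 0 := by rw [← Functor.map_comp, hπ, Functor.map_zero]
  obtain ⟨s₁, hs₁⟩ := ShortComplex.Exact.desc_injective D.exact_if
    (D.φ₀ ≫ R.X₀.map D.i - R.α X) (by
      rw [Preadditive.comp_sub, D.i_φ₀_assoc, R.α_natural, sub_self])
  obtain ⟨s₂, hs₂⟩ := ShortComplex.Exact.desc_injective D.exact_fg
    (D.φ₁ ≫ R.X₁.map D.i - s₁ ≫ R.d₀.app X) (by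
      rw [Preadditive.comp_sub, D.f_φ₁_assoc, reassoc_of% hs₁]
      simp [k₀])
  obtain ⟨s₃, hs₃⟩ := ShortComplex.Exact.desc_injective D.exact_gh
    (D.φ₂ ≫ R.X₂.map D.i - s₂ ≫ R.d₁.app X) (by
      rw [Preadditive.comp_sub, D.g_φ₂_assoc, reassoc_of% hs₂]
      simp [k₁])
  -- The last rung must lie over the identity of TX, but s₃ ≫ β is the identity only after
  -- composition with h. As TX is projective, β at X has a section r, and the error can be
  -- subtracted without changing h ≫ s₃.
  obtain ⟨r, hr⟩ := exists_lift_of_epi (R.β.app X) (𝟙 (T.obj X))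
  have hδ : h ≫ (s₃ ≫ R.β.app X - 𝟙 _) = 0 := by
    rw [Preadditive.comp_sub, reassoc_of% hs₃, Preadditive.sub_comp, Category.assoc,
      Category.assoc, k₂, R.zero₂, comp_zero, D.φ₂_β_assoc, hh]
    simp
  let t := s₃ - (s₃ ≫ R.β.app X - 𝟙 _) ≫ r
  have ht : h ≫ t = D.φ₂ ≫ R.X₂.map D.i - s₂ ≫ R.d₁.app X := by
    rw [Preadditive.comp_sub, hs₃, reassoc_of% hδ, zero_comp, sub_zero]
  have htβ : t ≫ R.β.app X = 𝟙 _ := by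
    simp [t, hr]
  exact ⟨{
    M := L, i := j, q := -T.map π
    if_zero := hjg
    fg_zero := D.g_h
    gq_zero := hhπ
    exact_if := exact_of_lift_projective _ fun Q _ x hx => by
      obtain ⟨y, hy⟩ := ShortComplex.Exact.lift_projective D.exact_fg x hx
      exact ⟨y ≫ π, by rw [Category.assoc, hj, hy]⟩
    exact_fg := D.exact_gh
    exact_gq := exact_of_lift_projective _ fun Q _ x hx => by
      obtain ⟨y, hy⟩ := ShortComplex.Exact.lift_projective (eπ.map T) x (by simpa using hx)
      obtain ⟨z, hz⟩ := exists_lift_of_epi D.q y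
      refine ⟨z, ?_⟩
      dsimp at hy
      rw [← hh, reassoc_of% hz, hy]
    q_map_i := by rw [Preadditive.neg_comp, ← T.map_comp, hj]
    φ₀ := (-s₁) ≫ R.X₀.map π
    φ₁ := s₂ ≫ R.X₁.map π
    φ₂ := (-t) ≫ R.X₂.map π
    i_φ₀ := by
      rw [← cancel_epi π, reassoc_of% hj, Preadditive.neg_comp, Preadditive.comp_neg,
        reassoc_of% hs₁, Preadditive.sub_comp, Category.assoc, c₀, R.α_natural]
      simp
    f_φ₁ := by
      rw [reassoc_of% hs₂]
      simp [c₁, n₀]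
    g_φ₂ := by
      rw [Preadditive.neg_comp, Preadditive.comp_neg, reassoc_of% ht]
      simp [c₂, n₁]
    φ₂_β := by
      rw [Preadditive.neg_comp, Preadditive.neg_comp, Category.assoc, n₂, reassoc_of% htβ] }⟩

/-- The five lemma for X ⟶ Y ⟶ Z ⟶ TX ⟶ TY, with elements replaced by morphisms from projectives. -/
theorem isIso_of_isIso [T.Additive] [PreservesFiniteLimits T] [PreservesFiniteColimits T]
    (D : R.StdTriangle f g h) {X' Y' Z' : A}
    {f' : X' ⟶ Y'} {g' : Y' ⟶ Z'} {h' : Z' ⟶ T.obj X'} (D' : R.StdTriangle f' g' h')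
    (a : X ⟶ X') (b : Y ⟶ Y') (c : Z ⟶ Z') [IsIso a] [IsIso b] (hab : f ≫ b = a ≫ f')
    (hbc : g ≫ c = b ≫ g') (hca : h ≫ T.map a = c ≫ h') : IsIso c := by
  have : Mono c := mono_of_projective fun Q _ x hx => by
    have hx' : x ≫ h = 0 := by
      rw [← cancel_mono (T.map a), Category.assoc, hca, reassoc_of% hx, zero_comp, zero_comp]
    obtain ⟨y, rfl⟩ := ShortComplex.Exact.lift_projective D.exact_gh x hx'
    rw [Category.assoc, hbc, ← Category.assoc] at hx
    obtain ⟨z, hz⟩ := ShortComplex.Exact.lift_projective D'.exact_fg _ hx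
    have : y = (z ≫ inv a) ≫ f := by
      rw [← cancel_mono b, ← hz]
      simp [hab]
    rw [this, Category.assoc, D.fg_zero, comp_zero]
  have : Epi c := epi_of_projective fun Q _ x => by
    obtain ⟨y, hy⟩ := ShortComplex.Exact.lift_projective D.exact_h_map_f
      (x ≫ h' ≫ T.map (inv a)) (by
        have : inv a ≫ f = f' ≫ inv b := by simp [hab]
        rw [Category.assoc, Category.assoc, ← T.map_comp, this, T.map_comp, reassoc_of% D'.h_map_f,
          zero_comp, comp_zero])
    have hy' : (x - y ≫ c) ≫ h' = 0 := by
      rw [Preadditive.sub_comp, Category.assoc, ← hca, reassoc_of% hy, ← T.map_comp]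
      simp
    obtain ⟨z, hz⟩ := ShortComplex.Exact.lift_projective D'.exact_gh _ hy'
    refine ⟨y + z ≫ inv b ≫ g, ?_⟩
    simp [hbc, hz]
  exact isIso_of_mono_of_epi c

end Rotation

end StdTriangle

end PeriodicResolution

namespace PeriodicResolution

variable {A : Type u} [Category.{v} A] [Abelian A] [EnoughProjectives A] {T : A ⥤ A}

namespace StdTriangle

/-! ### Completing a morphism to a standard triangle -/

section Completion

variable [EnoughInjectives A] (R : PeriodicResolution T)

/-- Every morphism between injective objects is the first morphism of a standard triangle. -/
theorem exists_of_injective (hA : ∀ Q : A, Projective Q ↔ Injective Q) {X Y : A} [Injective X]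
    [Injective Y] (f : X ⟶ Y) :
    ∃ (Z : A) (_ : Projective Z) (g : Y ⟶ Z) (h : Z ⟶ T.obj X), Nonempty (R.StdTriangle f g h) := by
  let M := kernel f
  let i : M ⟶ X := kernel.ι f
  have hi : i ≫ f = 0 := kernel.condition f
  have ei : (ShortComplex.mk _ _ hi).Exact :=
    ShortComplex.exact_of_f_is_kernel _ (kernelIsKernel f)
  -- J only serves to make coker f ⟶ C ⊞ J a monomorphism, where C is the image of d₁ at M.
  let J := Injective.under (cokernel f)
  let n : Y ⟶ J := cokernel.π f ≫ Injective.ι _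
  have hn : f ≫ n = 0 := by simp [n]
  have en : (ShortComplex.mk _ _ hn).Exact := by
    have e := ShortComplex.exact_of_g_is_cokernel (ShortComplex.mk f _ (cokernel.condition f))
      (cokernelIsCokernel f)
    exact (ShortComplex.exact_iff_of_epi_of_isIso_of_mono
      (ShortComplex.Hom.mk (S₁ := ShortComplex.mk f _ (cokernel.condition f))
        (S₂ := ShortComplex.mk _ _ hn) (𝟙 _) (𝟙 _) (Injective.ι _) (by simp) (by simp [n]))).1 e
  obtain ⟨φ₀, hφ₀⟩ := exists_extension_of_mono i (R.α M)
  obtain ⟨φ₁, hφ₁⟩ := ShortComplex.Exact.desc_injective ei (φ₀ ≫ R.d₀.app M) (by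
    rw [reassoc_of% hφ₀, R.zero₀])
  -- The mapping cone of the partial ladder, enlarged by J, is 0 ⟶ X ⟶ Y ⊞ X₀M ⟶ X₁M ⊞ J. It is
  -- exact, so its successive cokernels are injective; the last one, Q = `cokernel κ'`, is therefore
  -- also projective. Modulo the image of d₀ this gives a short exact sequence coker f ⟶ C ⊞ J ⟶ Q.
  let l : X ⟶ Y ⊞ R.X₀.obj M := biprod.lift f φ₀
  let κ : Y ⊞ R.X₀.obj M ⟶ R.X₁.obj M ⊞ J :=
    biprod.desc (biprod.lift φ₁ n) (biprod.lift (-R.d₀.app M) 0)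
  have hlκ : l ≫ κ = 0 := by
    apply biprod.hom_ext <;> simp [l, κ, hφ₁, hn]
  have : Mono l := mono_of_projective fun Q _ x hx => by
    have h₁ : x ≫ f = 0 := by simpa [l] using hx =≫ biprod.fst
    have h₂ : x ≫ φ₀ = 0 := by simpa [l] using hx =≫ biprod.snd
    obtain ⟨y, rfl⟩ := ShortComplex.Exact.lift_projective ei x h₁
    rw [Category.assoc, hφ₀] at h₂
    rw [zero_of_comp_mono _ h₂, zero_comp]
  have elκ : (ShortComplex.mk _ _ hlκ).Exact := exact_of_lift_projective _ fun Q _ x hx => by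
    have h₁ : (x ≫ biprod.fst) ≫ φ₁ - (x ≫ biprod.snd) ≫ R.d₀.app M = 0 := by
      have := hx =≫ biprod.fst
      rw [← biprod.lift_fst (x ≫ biprod.fst) (x ≫ biprod.snd)]
      simpa [κ, biprod.desc_eq, sub_eq_add_neg] using this
    have h₂ : (x ≫ biprod.fst) ≫ n = 0 := by
      simpa [κ, biprod.desc_eq] using hx =≫ biprod.snd
    obtain ⟨a, ha⟩ := ShortComplex.Exact.lift_projective en _ h₂
    obtain ⟨b, hb⟩ := ShortComplex.Exact.lift_projective (R.exact₀ M)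
      (x ≫ biprod.snd - a ≫ φ₀) (by
        rw [← ha] at h₁
        rw [Preadditive.sub_comp, Category.assoc, Category.assoc, ← hφ₁, ← neg_eq_zero, ← h₁]
        simp)
    refine ⟨a + b ≫ i, ?_⟩
    apply biprod.hom_ext
    · simp [l, ha, hi]
    · simp [l, hφ₀, hb]
  let p := cokernel.π l
  have hp : l ≫ p = 0 := cokernel.condition l
  have ep : (ShortComplex.mk _ _ hp).Exact :=
    ShortComplex.exact_of_g_is_cokernel _ (cokernelIsCokernel l)
  have : Injective (cokernel l) := injective_cokernel l p hp ep
  let κ' : cokernel l ⟶ R.X₁.obj M ⊞ J := cokernel.desc l κ hlκ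
  have hpκ' : p ≫ κ' = κ := cokernel.π_desc _ _ _
  have : Mono κ' := mono_of_projective fun Q _ x hx => by
    obtain ⟨y, rfl⟩ := exists_lift_of_epi p x
    rw [Category.assoc, hpκ'] at hx
    obtain ⟨z, rfl⟩ := ShortComplex.Exact.lift_projective elκ y hx
    rw [Category.assoc, hp, comp_zero]
  let ρ := cokernel.π κ'
  have hρ : κ' ≫ ρ = 0 := cokernel.condition κ'
  have eρ : (ShortComplex.mk _ _ hρ).Exact :=
    ShortComplex.exact_of_g_is_cokernel _ (cokernelIsCokernel κ')
  have : Injective (cokernel κ') := injective_cokernel κ' ρ hρ eρ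
  have : Projective (cokernel κ') := (hA _).2 inferInstance
  have hκρ : κ ≫ ρ = 0 := by rw [← hpκ', Category.assoc, hρ, comp_zero]
  have eκρ : ∀ (Q : A) [Projective Q] (x : Q ⟶ R.X₁.obj M ⊞ J), x ≫ ρ = 0 →
      ∃ x', x' ≫ κ = x := fun Q _ x hx => by
    obtain ⟨y, hy⟩ := ShortComplex.Exact.lift_projective eρ x hx
    obtain ⟨z, hz⟩ := exists_lift_of_epi p y
    exact ⟨z, by rw [← hpκ', reassoc_of% hz, hy]⟩
  -- Injectivity of Q extends C ⊞ J ⟶ Q to θ : X₂M ⊞ J ⟶ Q. The kernel Z of θ contains coker f with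
  -- quotient X₂M / C = TM, and it is projective because θ splits.
  obtain ⟨r, hr⟩ := ShortComplex.Exact.desc_injective (R.exact₁ M) (biprod.inl ≫ ρ) (by
    have : R.d₀.app M ≫ biprod.inl = -(biprod.inr ≫ κ) := by
      apply biprod.hom_ext <;> simp [κ]
    rw [reassoc_of% this, Preadditive.neg_comp, Category.assoc, hκρ, comp_zero, neg_zero])
  let θ : R.X₂.obj M ⊞ J ⟶ cokernel κ' := biprod.desc r (biprod.inr ≫ ρ)
  have hθ : ∀ {Q : A} (z : Q ⟶ R.X₁.obj M) (j : Q ⟶ J),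
      biprod.lift (z ≫ R.d₁.app M) j ≫ θ = biprod.lift z j ≫ ρ := fun z j => by
    rw [biprod.lift_desc, Category.assoc, hr, ← Category.assoc, ← Category.assoc,
      ← Preadditive.add_comp]
    congr 1
    apply biprod.hom_ext <;> simp
  have : Epi θ := epi_of_projective fun Q _ x => by
    obtain ⟨y, hy⟩ := exists_lift_of_epi ρ x
    refine ⟨biprod.lift ((y ≫ biprod.fst) ≫ R.d₁.app M) (y ≫ biprod.snd), ?_⟩
    rw [hθ, ← hy]
    congr 1
    apply biprod.hom_ext <;> simp
  let Z := kernel θ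
  let ζ : Z ⟶ R.X₂.obj M ⊞ J := kernel.ι θ
  have hζ : ζ ≫ θ = 0 := kernel.condition θ
  have : Projective Z := by
    have : Projective J := (hA _).2 inferInstance
    obtain ⟨s, hs⟩ := exists_lift_of_epi θ (𝟙 _)
    let t : R.X₂.obj M ⊞ J ⟶ Z := kernel.lift θ (𝟙 _ - θ ≫ s) (by simp [hs])
    have ht : t ≫ ζ = 𝟙 _ - θ ≫ s := kernel.lift_ι _ _ _
    have hζt : ζ ≫ t = 𝟙 Z := by
      rw [← cancel_mono ζ, Category.assoc, ht, Preadditive.comp_sub, reassoc_of% hζ]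
      simp
    exact Retract.projective ⟨ζ, t, hζt⟩
  let g : Y ⟶ Z := kernel.lift θ (biprod.lift (φ₁ ≫ R.d₁.app M) n) (by
    rw [hθ, ← biprod.inl_desc (biprod.lift φ₁ n) (biprod.lift (-R.d₀.app M) 0), Category.assoc]
    change _ ≫ κ ≫ ρ = 0
    rw [hκρ, comp_zero])
  have hg : g ≫ ζ = biprod.lift (φ₁ ≫ R.d₁.app M) n := kernel.lift_ι _ _ _
  let q : Z ⟶ T.obj M := ζ ≫ biprod.fst ≫ R.β.app M
  have hfg : f ≫ g = 0 := by
    rw [← cancel_mono ζ, Category.assoc, hg]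
    apply biprod.hom_ext <;> simp [reassoc_of% hφ₁, hn]
  have hgq : g ≫ q = 0 := by simp [q, reassoc_of% hg]
  have : Epi q := epi_of_projective fun Q _ x => by
    -- A preimage y of x under β is moved into ker θ by subtracting (z₁ ≫ d₁, z₂), where z lifts y ≫
    -- r along ρ: this has the same image under θ, and β kills its first component.
    obtain ⟨y, hy⟩ := exists_lift_of_epi (R.β.app M) x
    obtain ⟨z, hz⟩ := exists_lift_of_epi ρ (y ≫ r)
    refine ⟨kernel.lift θ (biprod.lift (y - (z ≫ biprod.fst) ≫ R.d₁.app M) (-(z ≫ biprod.snd))) ?_,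
      ?_⟩
    · have : biprod.lift (y - (z ≫ biprod.fst) ≫ R.d₁.app M) (-(z ≫ biprod.snd)) =
          y ≫ biprod.inl - biprod.lift ((z ≫ biprod.fst) ≫ R.d₁.app M) (z ≫ biprod.snd) := by
        apply biprod.hom_ext <;> simp
      have hz' : biprod.lift (z ≫ biprod.fst) (z ≫ biprod.snd) = z := by
        apply biprod.hom_ext <;> simp
      rw [this, Preadditive.sub_comp, hθ, hz', hz]
      simp [θ]
    · change _ ≫ kernel.ι θ ≫ _ = _
      rw [kernel.lift_ι_assoc]
      simp [hy]
  refine ⟨Z, inferInstance, g, q ≫ T.map i, ⟨{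
    M := M, i := i, q := q
    if_zero := hi
    fg_zero := hfg
    gq_zero := hgq
    exact_if := ei
    exact_fg := exact_of_lift_projective _ fun Q _ x hx =>
      ShortComplex.Exact.lift_projective en x (by
        have := (hx =≫ ζ) =≫ biprod.snd
        simpa [hg] using this)
    exact_gq := exact_of_lift_projective _ fun Q _ x hx => by
      obtain ⟨z, hz⟩ := ShortComplex.Exact.lift_projective (R.exact₂ M)
        (x ≫ ζ ≫ biprod.fst) (by simpa [q] using hx)
      have hx' : x ≫ ζ = biprod.lift (z ≫ R.d₁.app M) (x ≫ ζ ≫ biprod.snd) := by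
        apply biprod.hom_ext <;> simp [hz]
      obtain ⟨y, hy⟩ := eκρ Q (biprod.lift z (x ≫ ζ ≫ biprod.snd)) (by
        rw [← hθ, ← hx', Category.assoc, hζ, comp_zero])
      have hy₁ : (y ≫ biprod.fst) ≫ φ₁ - (y ≫ biprod.snd) ≫ R.d₀.app M = z := by
        simpa [κ, biprod.desc_eq, sub_eq_add_neg] using hy =≫ biprod.fst
      have hy₂ : (y ≫ biprod.fst) ≫ n = x ≫ ζ ≫ biprod.snd := by
        simpa [κ, biprod.desc_eq] using hy =≫ biprod.snd
      refine ⟨y ≫ biprod.fst, ?_⟩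
      rw [← cancel_mono ζ, hx', Category.assoc, hg, ← hy₁, ← hy₂]
      apply biprod.hom_ext <;> simp
    q_map_i := rfl
    φ₀ := φ₀
    φ₁ := φ₁
    φ₂ := ζ ≫ biprod.fst
    i_φ₀ := hφ₀
    f_φ₁ := hφ₁
    g_φ₂ := by rw [reassoc_of% hg, biprod.lift_fst]
    φ₂_β := by rw [Category.assoc] }⟩⟩

end Completion

/-! ### Mapping cones and the octahedral axiom -/

section Octahedron

variable {R : PeriodicResolution T}

/-- Cancelling a contractible summand of a standard triangle. -/
theorem nonempty_of_biprod {Y Y' Z V W : A} {c : Y ⟶ Z} {g' : Y' ⟶ Z} {e : Z ⟶ V}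
    {g'' : Y' ⟶ V} {h'' : V ⟶ T.obj W} {v' : W ⟶ Y'} {k : W ⟶ Y}
    (D : R.StdTriangle (biprod.lift biprod.fst (biprod.desc g' (-c)) : Y' ⊞ Y ⟶ Y' ⊞ Z)
      (biprod.desc g'' (-e)) (h'' ≫ T.map (biprod.lift v' k)))
    (hg : g' ≫ e = g'') :
    Nonempty (R.StdTriangle c e (h'' ≫ T.map k)) := by
  have H : ∀ {Q : A} (x : Q ⟶ Y' ⊞ Y), x ≫ biprod.lift biprod.fst (biprod.desc g' (-c)) = 0 →
      x ≫ biprod.fst = 0 ∧ (x ≫ biprod.snd) ≫ c = 0 := fun x hx => by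
    have h₁ : x ≫ biprod.fst = 0 := by simpa using hx =≫ biprod.fst
    have h₂ := hx =≫ biprod.snd
    rw [Category.assoc, biprod.lift_snd, biprod.desc_eq] at h₂
    exact ⟨h₁, by simpa [reassoc_of% h₁] using h₂⟩
  obtain ⟨hi₁, hi₂⟩ := H D.i D.if_zero
  have hi : (D.i ≫ biprod.snd) ≫ biprod.inr = D.i := by
    apply biprod.hom_ext <;> simp [hi₁]
  have hce : c ≫ e = 0 := by
    have := biprod.inr ≫= D.fg_zero
    rw [← Category.assoc] at this
    simpa using this
  have heq : e ≫ D.q = 0 := by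
    have := biprod.inr ≫= D.gq_zero
    rw [biprod.inr_desc_assoc] at this
    simpa using this
  have : Mono (D.i ≫ biprod.snd) := by
    have : Mono ((D.i ≫ biprod.snd) ≫ (biprod.inr : Y ⟶ Y' ⊞ Y)) := by
      rw [hi]
      infer_instance
    exact mono_of_mono _ (biprod.inr : Y ⟶ Y' ⊞ Y)
  -- The reduced sequence embeds in the given one by `biprod.inr`, `-biprod.inr` and the identity,
  -- so its ladder is a restriction.
  refine ⟨D.precomp (D.i ≫ biprod.snd) D.q hi₂ hce heq
    (exact_of_lift_projective _ fun Q _ x hx => ?_) (exact_of_lift_projective _ fun Q _ x hx => ?_)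
    (exact_of_lift_projective _ fun Q _ x hx => ?_) ?_ biprod.inr (-biprod.inr) (𝟙 V) hi ?_ ?_ ?_⟩
  · obtain ⟨y, hy⟩ := ShortComplex.Exact.lift_projective D.exact_if (x ≫ biprod.inr) (by
      apply biprod.hom_ext <;> simp [hx])
    exact ⟨y, by rw [reassoc_of% hy]; simp⟩
  · obtain ⟨y, hy⟩ := ShortComplex.Exact.lift_projective D.exact_fg (x ≫ biprod.inr) (by
      simp [hx])
    have h₁ : y ≫ biprod.fst = 0 := by simpa using hy =≫ biprod.fst
    refine ⟨-(y ≫ biprod.snd), ?_⟩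
    simpa [biprod.desc_eq, reassoc_of% h₁] using hy =≫ biprod.snd
  · obtain ⟨y, hy⟩ := ShortComplex.Exact.lift_projective D.exact_gq x hx
    refine ⟨y ≫ biprod.fst ≫ g' - y ≫ biprod.snd, ?_⟩
    rw [← hy]
    simp [biprod.desc_eq, hg, sub_eq_add_neg]
  · have := D.q_map_i =≫ T.map biprod.snd
    rw [Category.assoc, Category.assoc, ← T.map_comp, ← T.map_comp, biprod.lift_snd] at this
    exact this
  · apply biprod.hom_ext <;> simp
  · simp
  · simp

variable [T.Additive] [PreservesFiniteLimits T]
  [PreservesFiniteColimits T]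

/-- Given standard triangles on `f` and on `f ≫ v`, the induced morphism of triangles can be chosen
such that its (reduced) mapping cone is standard. -/
theorem exists_cone {X Y Z Y' Z' : A} {f : X ⟶ Y} {g : Y ⟶ Z} {h : Z ⟶ T.obj X}
    {f' : X ⟶ Y'} {g' : Y' ⟶ Z'} {h' : Z' ⟶ T.obj X} (D : R.StdTriangle f g h)
    (D' : R.StdTriangle f' g' h') [Injective Z'] (v : Y ⟶ Y') (hv : f ≫ v = f') :
    ∃ c : Z ⟶ Z', g ≫ c = v ≫ g' ∧ c ≫ h' = h ∧
      Nonempty (R.StdTriangle (biprod.lift v g) (biprod.desc g' (-c)) (h' ≫ T.map f)) := by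
  obtain ⟨m, c, s₁, s₂, s₃, σ, hm, hc, hcq, hσ, hs₁, hs₂, hs₃⟩ :=
    D.exists_comparison D' (𝟙 X) v (by simpa using hv)
  rw [Category.comp_id] at hm
  rw [Category.id_comp] at hs₁
  have hh := D.q_map_i
  have hh' := D'.q_map_i
  have hch : c ≫ h' = h := by
    rw [← hh, ← hh', reassoc_of% hcq, ← T.map_comp, hm]
  have : Mono m := by
    have : Mono (m ≫ D'.i) := by rw [hm]; infer_instance
    exact mono_of_mono m D'.i
  -- The cone belongs to I = ker (f ≫ v) / ker f, which f embeds in Y as the kernel of (v, g).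
  let I := cokernel m
  let p : D'.M ⟶ I := cokernel.π m
  have hp : m ≫ p = 0 := cokernel.condition m
  have ep : (ShortComplex.mk _ _ hp).Exact :=
    ShortComplex.exact_of_g_is_cokernel _ (cokernelIsCokernel m)
  let k : I ⟶ Y := cokernel.desc m (D'.i ≫ f) (by rw [reassoc_of% hm, D.if_zero])
  have hk : p ≫ k = D'.i ≫ f := cokernel.π_desc _ _ _
  have n₀ : R.X₀.map p ≫ R.d₀.app _ = R.d₀.app _ ≫ R.X₁.map p := R.d₀.naturality p
  have n₁ : R.X₁.map p ≫ R.d₁.app _ = R.d₁.app _ ≫ R.X₂.map p := R.d₁.naturality p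
  have n₂ : R.X₂.map p ≫ R.β.app _ = R.β.app _ ≫ T.map p := R.β.naturality p
  have c₀ : R.X₀.map m ≫ R.X₀.map p = 0 := by rw [← Functor.map_comp, hp, Functor.map_zero]
  have c₁ : R.X₁.map m ≫ R.X₁.map p = 0 := by rw [← Functor.map_comp, hp, Functor.map_zero]
  have c₂ : R.X₂.map m ≫ R.X₂.map p = 0 := by rw [← Functor.map_comp, hp, Functor.map_zero]
  have cT : T.map m ≫ T.map p = 0 := by rw [← Functor.map_comp, hp, Functor.map_zero]
  -- Extending `s₃` alone and composing with σ afterwards keeps the correction invisible to β, as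
  -- the condition on the last rung requires. An arbitrary extension of `s₃ ≫ σ` need not have this
  -- property.
  obtain ⟨s, hs⟩ := exists_extension_of_mono (T.map m) s₃
  have w₁ : k ≫ biprod.lift v g = 0 := by
    rw [← cancel_epi p, reassoc_of% hk]
    apply biprod.hom_ext <;> simp [hv, D.fg_zero]
  have w₂ : biprod.lift v g ≫ biprod.desc g' (-c) = 0 := by
    simp [hc]
  have w₃ : biprod.desc g' (-c) ≫ D'.q ≫ T.map p = 0 := by
    apply biprod.hom_ext' <;> simp [reassoc_of% hcq, cT]
  have : Mono k := mono_of_projective fun Q _ x hx => by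
    obtain ⟨y, rfl⟩ := exists_lift_of_epi p x
    rw [Category.assoc, hk, ← Category.assoc] at hx
    obtain ⟨z, hz⟩ := ShortComplex.Exact.lift_projective D.exact_if _ hx
    have : y = z ≫ m := by rw [← cancel_mono D'.i, ← hz, Category.assoc, hm]
    rw [this, Category.assoc, hp, comp_zero]
  refine ⟨c, hc, hch, ⟨{
    M := I, i := k, q := D'.q ≫ T.map p
    if_zero := w₁
    fg_zero := w₂
    gq_zero := w₃
    exact_if := exact_of_lift_projective _ fun Q _ x hx => by
      have h₁ : x ≫ v = 0 := by simpa using hx =≫ biprod.fst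
      have h₂ : x ≫ g = 0 := by simpa using hx =≫ biprod.snd
      obtain ⟨y, rfl⟩ := ShortComplex.Exact.lift_projective D.exact_fg x h₂
      rw [Category.assoc, hv] at h₁
      obtain ⟨z, rfl⟩ := ShortComplex.Exact.lift_projective D'.exact_if y h₁
      exact ⟨z ≫ p, by rw [Category.assoc, hk, Category.assoc]⟩
    exact_fg := exact_of_lift_projective _ fun Q _ x hx => by
      have hx' : (x ≫ biprod.fst) ≫ g' = (x ≫ biprod.snd) ≫ c := by
        simpa [biprod.desc_eq, sub_eq_zero, ← sub_eq_add_neg] using hx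
      obtain ⟨y, hy⟩ := ShortComplex.Exact.lift_projective D.exact_gq (x ≫ biprod.snd) (by
        have := hx' =≫ D'.q
        rw [← cancel_mono (T.map m), Category.assoc _ D.q, ← hcq, ← Category.assoc, ← this]
        simp)
      obtain ⟨z, hz⟩ := ShortComplex.Exact.lift_projective D'.exact_fg
        (x ≫ biprod.fst - y ≫ v) (by
          rw [Preadditive.sub_comp, hx', ← hy, Category.assoc, Category.assoc, hc, sub_self])
      refine ⟨y + z ≫ f, ?_⟩
      apply biprod.hom_ext
      · simp [hv, hz]
      · simp [hy, D.fg_zero]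
    exact_gq := exact_of_lift_projective _ fun Q _ x hx => by
      rw [← Category.assoc] at hx
      obtain ⟨y, hy⟩ := ShortComplex.Exact.lift_projective (ep.map T) _ hx
      dsimp at hy
      obtain ⟨z, hz⟩ := exists_lift_of_epi D.q y
      obtain ⟨b, hb⟩ := ShortComplex.Exact.lift_projective D'.exact_gq (x - z ≫ c) (by
        rw [Preadditive.sub_comp, Category.assoc, hcq, reassoc_of% hz, hy, sub_self])
      exact ⟨biprod.lift b (-z), by simp [hb]⟩
    q_map_i := by
      rw [Category.assoc, ← T.map_comp, hk, T.map_comp, D'.q_map_i_assoc]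
    φ₀ := s₁ ≫ R.X₀.map p
    φ₁ := biprod.desc (D'.φ₁ ≫ R.X₁.map p) (-(s₂ ≫ R.X₁.map p))
    φ₂ := D'.φ₂ ≫ R.X₂.map p - D'.q ≫ s ≫ σ ≫ R.X₂.map p
    i_φ₀ := by
      rw [← cancel_epi p, reassoc_of% hk, R.α_natural, ← D'.i_φ₀, Category.assoc, hs₁]
      simp [c₀]
    f_φ₁ := by
      rw [biprod.lift_desc, reassoc_of% hs₂]
      simp [c₁, n₀]
    g_φ₂ := by
      apply biprod.hom_ext'
      · simp [D'.g_φ₂_assoc, n₁]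
      · simp only [biprod.inr_desc_assoc, Preadditive.comp_sub, Preadditive.neg_comp,
          reassoc_of% hs₃, reassoc_of% hcq, reassoc_of% hs]
        simp [c₂, n₁]
    φ₂_β := by
      rw [Preadditive.sub_comp, Category.assoc, n₂, D'.φ₂_β_assoc]
      simp [n₂, reassoc_of% hσ] }⟩⟩

end Octahedron

end StdTriangle

end PeriodicResolution

namespace PeriodicResolution

/-! ### Transport of the triangulation to `P` -/

section Triangulated

variable {P : Type u} [Category.{v} P] [Preadditive P] [HasShift P ℤ]
  {A : Type*} [Category* A] [Abelian A] {T : A ⥤ A}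
  (R : PeriodicResolution T) (y : P ⥤ A) (ε : shiftFunctor P (1 : ℤ) ⋙ y ≅ y ⋙ T)

/-- A triangle of `P` is distinguished if its image in `A` is standard. -/
def IsDistinguished {X Y Z : P} (f : X ⟶ Y) (g : Y ⟶ Z) (h : Z ⟶ X⟦(1 : ℤ)⟧) : Prop :=
  Nonempty (R.StdTriangle (y.map f) (y.map g) (y.map h ≫ ε.hom.app X))

namespace IsDistinguished

variable {R y ε} {X Y Z X' Y' Z' : P} {f : X ⟶ Y} {g : Y ⟶ Z} {h : Z ⟶ X⟦(1 : ℤ)⟧}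
  {f' : X' ⟶ Y'} {g' : Y' ⟶ Z'} {h' : Z' ⟶ X'⟦(1 : ℤ)⟧}

theorem map_shift_naturality {X X' : P} (a : X ⟶ X') :
    y.map (a⟦(1 : ℤ)⟧') ≫ ε.hom.app X' = ε.hom.app X ≫ T.map (y.map a) :=
  ε.hom.naturality a

theorem of_iso (H : R.IsDistinguished y ε f' g' h') (a : X ≅ X') (b : Y ≅ Y') (c : Z ≅ Z')
    (hab : f ≫ b.hom = a.hom ≫ f') (hbc : g ≫ c.hom = b.hom ≫ g')
    (hca : h ≫ a.hom⟦1⟧' = c.hom ≫ h') : R.IsDistinguished y ε f g h := by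
  obtain ⟨D⟩ := H
  refine ⟨D.ofIso (y.mapIso a) (y.mapIso b) (y.mapIso c) ?_ ?_ ?_⟩
  · simp [← Functor.map_comp, hab]
  · simp [← Functor.map_comp, hbc]
  · rw [Functor.mapIso_hom, Functor.mapIso_hom, Category.assoc, ← map_shift_naturality,
      ← y.map_comp_assoc, ← y.map_comp_assoc, hca]

theorem of_isZero [y.Additive] [T.Additive] (hZ : IsZero Z) (g : X ⟶ Z)
    (h : Z ⟶ X⟦(1 : ℤ)⟧) : R.IsDistinguished y ε (𝟙 X) g h := by
  have := StdTriangle.nonempty_contractible (R := R) (y.map_isZero hZ) (y.map g)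
    (y.map h ≫ ε.hom.app X)
  rwa [← y.map_id] at this

variable [y.Full] [y.Faithful]

theorem exists_completion [∀ X, Injective (y.obj X)] (H : R.IsDistinguished y ε f g h)
    (H' : R.IsDistinguished y ε f' g' h') (a : X ⟶ X') (b : Y ⟶ Y')
    (hab : f ≫ b = a ≫ f') :
    ∃ c : Z ⟶ Z', g ≫ c = b ≫ g' ∧ h ≫ a⟦1⟧' = c ≫ h' := by
  obtain ⟨D⟩ := H
  obtain ⟨D'⟩ := H'
  obtain ⟨c, hc₁, hc₂⟩ := D.exists_completion D' (y.map a) (y.map b) (by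
    rw [← y.map_comp, ← y.map_comp, hab])
  obtain ⟨c, rfl⟩ := y.map_surjective c
  refine ⟨c, y.map_injective (by simpa using hc₁), y.map_injective ?_⟩
  rw [← cancel_mono (ε.hom.app _), y.map_comp, y.map_comp, Category.assoc, Category.assoc, ← hc₂,
    Category.assoc, map_shift_naturality]

variable [EnoughProjectives A]

section

variable [T.Additive] [PreservesFiniteLimits T] [PreservesFiniteColimits T]

theorem isIso_of_isIso (H : R.IsDistinguished y ε f g h) (H' : R.IsDistinguished y ε f' g' h')
    (a : X ⟶ X') (b : Y ⟶ Y') (c : Z ⟶ Z') [IsIso a] [IsIso b] (hab : f ≫ b = a ≫ f')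
    (hbc : g ≫ c = b ≫ g') (hca : h ≫ a⟦1⟧' = c ≫ h') : IsIso c := by
  obtain ⟨D⟩ := H
  obtain ⟨D'⟩ := H'
  have : IsIso (y.map c) := D.isIso_of_isIso D' (y.map a) (y.map b) _
    (by rw [← y.map_comp, ← y.map_comp, hab]) (by rw [← y.map_comp, ← y.map_comp, hbc])
    (by
      rw [Category.assoc, ← map_shift_naturality, ← y.map_comp_assoc, hca, y.map_comp,
        Category.assoc])
  exact isIso_of_reflects_iso c y

variable [y.Additive] [∀ X, Projective (y.obj X)]

omit [y.Full] [y.Faithful] in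
theorem rotate (H : R.IsDistinguished y ε f g h) : R.IsDistinguished y ε g h (-f⟦1⟧') := by
  obtain ⟨D⟩ := H
  have : Projective (T.obj (y.obj X)) :=
    Projective.of_iso (ε.app X) (inferInstanceAs (Projective (y.obj _)))
  obtain ⟨D'⟩ := D.nonempty_rotate
  refine ⟨D'.ofIso (Iso.refl _) (Iso.refl _) (ε.app X) (by simp) (by simp) ?_⟩
  rw [y.map_neg, Preadditive.neg_comp, map_shift_naturality]
  simp

end

variable [EnoughInjectives A] [∀ X, Injective (y.obj X)]

theorem exists_of_hom (hA : ∀ Q : A, Projective Q ↔ Injective Q)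
    (hy : ∀ Q : A, Projective Q → ∃ X : P, Nonempty (y.obj X ≅ Q)) {X Y : P} (f : X ⟶ Y) :
    ∃ (Z : P) (g : Y ⟶ Z) (h : Z ⟶ X⟦(1 : ℤ)⟧), R.IsDistinguished y ε f g h := by
  obtain ⟨Z, hZ, g, h, ⟨D⟩⟩ := StdTriangle.exists_of_injective R hA (y.map f)
  obtain ⟨Z, ⟨e⟩⟩ := hy Z hZ
  obtain ⟨g', hg'⟩ := y.map_surjective (g ≫ e.inv)
  obtain ⟨h', hh'⟩ := y.map_surjective (e.hom ≫ h ≫ ε.inv.app X)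
  exact ⟨Z, g', h', ⟨D.ofIso (Iso.refl _) (Iso.refl _) e (by simp) (by simp [hg'])
    (by simp [hh'])⟩⟩

variable [T.Additive] [PreservesFiniteLimits T] [PreservesFiniteColimits T] [y.Additive]
  [∀ X, Projective (y.obj X)]

/-- Rotation is inverted by comparison with a triangle on f: two further rotations of the hypothesis
and three of that triangle both begin with -f⟦1⟧. The five lemma makes them isomorphic, and the
isomorphism descends because the shift is fully faithful. -/
theorem of_rotate [∀ n : ℤ, (shiftFunctor P n).Additive]
    (hA : ∀ Q : A, Projective Q ↔ Injective Q)
    (hy : ∀ Q : A, Projective Q → ∃ X : P, Nonempty (y.obj X ≅ Q))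
    (H : R.IsDistinguished y ε g h (-f⟦1⟧')) : R.IsDistinguished y ε f g h := by
  obtain ⟨Z', g', h', H'⟩ := exists_of_hom (R := R) (ε := ε) hA hy f
  have h₁ := H.rotate.rotate
  have h₂ := H'.rotate.rotate.rotate
  obtain ⟨c, hc₁, hc₂⟩ := exists_completion h₁ h₂ (𝟙 _) (𝟙 _) (by simp)
  have : IsIso c := isIso_of_isIso h₁ h₂ (𝟙 _) (𝟙 _) c (by simp) hc₁ hc₂
  obtain ⟨c, rfl⟩ := (shiftFunctor P (1 : ℤ)).map_surjective c
  have : IsIso c := isIso_of_reflects_iso c (shiftFunctor P (1 : ℤ))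
  refine H'.of_iso (Iso.refl _) (Iso.refl _) (asIso c) (by simp)
    ((shiftFunctor P (1 : ℤ)).map_injective ?_) ((shiftFunctor P (1 : ℤ)).map_injective ?_)
  · simpa using hc₁
  · simpa using hc₂

omit [EnoughInjectives A] [y.Additive] [∀ X, Projective (y.obj X)] in
theorem exists_octahedron {X₁ X₂ X₃ Z₁₂ Z₂₃ Z₁₃ : P} {u₁₂ : X₁ ⟶ X₂} {u₂₃ : X₂ ⟶ X₃}
    {u₁₃ : X₁ ⟶ X₃} (comm : u₁₂ ≫ u₂₃ = u₁₃) {v₁₂ : X₂ ⟶ Z₁₂} {w₁₂ : Z₁₂ ⟶ X₁⟦(1 : ℤ)⟧}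
    (h₁₂ : R.IsDistinguished y ε u₁₂ v₁₂ w₁₂)
    {v₂₃ : X₃ ⟶ Z₂₃} {w₂₃ : Z₂₃ ⟶ X₂⟦(1 : ℤ)⟧} (h₂₃ : R.IsDistinguished y ε u₂₃ v₂₃ w₂₃)
    {v₁₃ : X₃ ⟶ Z₁₃} {w₁₃ : Z₁₃ ⟶ X₁⟦(1 : ℤ)⟧} (h₁₃ : R.IsDistinguished y ε u₁₃ v₁₃ w₁₃) :
    ∃ (m₁ : Z₁₂ ⟶ Z₁₃) (m₃ : Z₁₃ ⟶ Z₂₃), v₁₂ ≫ m₁ = u₂₃ ≫ v₁₃ ∧ m₁ ≫ w₁₃ = w₁₂ ∧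
      v₁₃ ≫ m₃ = v₂₃ ∧ w₁₃ ≫ u₁₂⟦1⟧' = m₃ ≫ w₂₃ ∧
      R.IsDistinguished y ε m₁ m₃ (w₂₃ ≫ v₁₂⟦1⟧') := by
  obtain ⟨D₁₂⟩ := h₁₂
  obtain ⟨D₂₃⟩ := h₂₃
  obtain ⟨D₁₃⟩ := h₁₃
  obtain ⟨m₁, hm₁, hm₁', ⟨D⟩⟩ := D₁₂.exists_cone D₁₃ (y.map u₂₃) (by rw [← y.map_comp, comm])
  -- The cone X₂ ⟶ X₃ ⊞ Z₁₂ ⟶ Z₁₃ is compared with the triangle on `u₂₃` through the projection to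
  -- X₃. The new cone is the desired triangle on `m₁` plus the contractible summand X₃ ⟶ X₃.
  obtain ⟨m₃, hm₃, hm₃', ⟨D'⟩⟩ := D.exists_cone D₂₃ biprod.fst (by simp)
  obtain ⟨m₁, rfl⟩ := y.map_surjective m₁
  obtain ⟨m₃, rfl⟩ := y.map_surjective m₃
  have hm₃₁ : y.map v₁₃ ≫ y.map m₃ = y.map v₂₃ := by
    have := biprod.inl ≫= hm₃
    simpa using this
  obtain ⟨D''⟩ := D'.nonempty_of_biprod hm₃₁
  refine ⟨m₁, m₃, y.map_injective (by simpa using hm₁), y.map_injective ?_,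
    y.map_injective (by simpa using hm₃₁), y.map_injective ?_, ?_⟩
  · rw [← cancel_mono (ε.hom.app X₁), y.map_comp, Category.assoc, hm₁']
  · rw [← cancel_mono (ε.hom.app X₂), y.map_comp, y.map_comp, Category.assoc, Category.assoc, hm₃',
      Category.assoc, map_shift_naturality]
  · rw [IsDistinguished, y.map_comp, Category.assoc, map_shift_naturality, ← Category.assoc]
    exact ⟨D''⟩

end IsDistinguished

variable [HasZeroObject P] [∀ n : ℤ, (shiftFunctor P n).Additive]
  [y.Full] [y.Faithful] [∀ X, Injective (y.obj X)] [EnoughProjectives A]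
  [EnoughInjectives A] [T.Additive] [PreservesFiniteLimits T] [PreservesFiniteColimits T]
  [y.Additive] [∀ X, Projective (y.obj X)]

/-- The triangulated structure given by the images of standard triangles. -/
@[reducible]
def pretriangulated (hA : ∀ Q : A, Projective Q ↔ Injective Q)
    (hy : ∀ Q : A, Projective Q → ∃ X : P, Nonempty (y.obj X ≅ Q)) : Pretriangulated P where
  distinguishedTriangles := {t | R.IsDistinguished y ε t.mor₁ t.mor₂ t.mor₃}
  isomorphic_distinguished _ ht _ e := IsDistinguished.of_iso ht (Triangle.π₁.mapIso e)
    (Triangle.π₂.mapIso e) (Triangle.π₃.mapIso e) e.hom.comm₁ e.hom.comm₂ e.hom.comm₃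
  contractible_distinguished _ := IsDistinguished.of_isZero (isZero_zero P) _ _
  distinguished_cocone_triangle f := IsDistinguished.exists_of_hom hA hy f
  rotate_distinguished_triangle _ :=
    ⟨fun ht => IsDistinguished.rotate ht, fun ht => IsDistinguished.of_rotate hA hy ht⟩
  complete_distinguished_triangle_morphism _ _ ht ht' a b hab :=
    IsDistinguished.exists_completion ht ht' a b hab

theorem isTriangulated (hA : ∀ Q : A, Projective Q ↔ Injective Q)
    (hy : ∀ Q : A, Projective Q → ∃ X : P, Nonempty (y.obj X ≅ Q)) :
    letI := R.pretriangulated y ε hA hy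
    IsTriangulated P :=
  letI := R.pretriangulated y ε hA hy
  { octahedron_axiom := fun comm _ _ h₁₂ _ _ h₂₃ _ _ h₁₃ => by
      obtain ⟨m₁, m₃, c₁, c₂, c₃, c₄, h⟩ := IsDistinguished.exists_octahedron comm h₁₂ h₂₃ h₁₃
      exact ⟨⟨m₁, m₃, c₁, c₂, c₃, c₄, h⟩⟩ }

end Triangulated

end PeriodicResolution

/-! ### A ℤ-shift generated by an auto-equivalence -/

section ShiftOfEquivalence

variable {P : Type u} [Category.{v} P]

/-- A sequence of objects `Xₙ` indexed by the integers with isomorphisms `S Xₙ ≅ Xₙ₊₁`. -/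
structure OrbitSequence (S : P ⥤ P) where
  (obj : ℤ → P)
  (iso (n : ℤ) : S.obj (obj n) ≅ obj (n + 1))

namespace OrbitSequence

variable {S : P ⥤ P}

/-- A morphism of sequences, compatible with the structure isomorphisms. -/
@[ext]
structure Hom (X Y : OrbitSequence S) where
  (app (n : ℤ) : X.obj n ⟶ Y.obj n)
  (comm (n : ℤ) : S.map (app n) ≫ (Y.iso n).hom = (X.iso n).hom ≫ app (n + 1))

instance : Category (OrbitSequence S) where
  Hom := Hom
  id X := ⟨fun n => 𝟙 (X.obj n), fun n => by simp⟩
  comp f g := ⟨fun n => f.app n ≫ g.app n, fun n => by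
    rw [S.map_comp, Category.assoc, g.comm, ← Category.assoc, f.comm, Category.assoc]⟩

@[simp]
theorem id_app (X : OrbitSequence S) (n : ℤ) : Hom.app (𝟙 X) n = 𝟙 _ := rfl

@[simp]
theorem comp_app {X Y Z : OrbitSequence S} (f : X ⟶ Y) (g : Y ⟶ Z) (n : ℤ) :
    Hom.app (f ≫ g) n = Hom.app f n ≫ Hom.app g n := rfl

@[ext]
theorem hom_ext {X Y : OrbitSequence S} {f g : X ⟶ Y} (h : ∀ n, Hom.app f n = Hom.app g n) :
    f = g :=
  Hom.ext (funext h)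

/-- Constructor for isomorphisms. -/
@[simps]
def isoMk {X Y : OrbitSequence S} (e : ∀ n, X.obj n ≅ Y.obj n)
    (comm : ∀ n, S.map (e n).hom ≫ (Y.iso n).hom = (X.iso n).hom ≫ (e (n + 1)).hom) : X ≅ Y where
  hom := ⟨fun n => (e n).hom, comm⟩
  inv := ⟨fun n => (e n).inv, fun n => by
    rw [← cancel_mono (e (n + 1)).hom, Category.assoc, ← comm, ← S.map_comp_assoc]
    simp⟩
  hom_inv_id := by ext n; exact (e n).hom_inv_id
  inv_hom_id := by ext n; exact (e n).inv_hom_id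

/-- The isomorphism between two terms of a sequence whose indices agree. -/
def castIso (X : OrbitSequence S) {m n : ℤ} (h : m = n) : X.obj m ≅ X.obj n :=
  eqToIso (congrArg X.obj h)

@[simp]
theorem castIso_rfl (X : OrbitSequence S) (m : ℤ) : X.castIso (rfl : m = m) = Iso.refl _ := rfl

@[simp]
theorem castIso_trans (X : OrbitSequence S) {l m n : ℤ} (h : l = m) (h' : m = n) :
    (X.castIso h).hom ≫ (X.castIso h').hom = (X.castIso (h.trans h')).hom := by
  subst h h'
  simp

theorem iso_castIso (X : OrbitSequence S) {m n : ℤ} (h : m = n) (h' : m + 1 = n + 1) :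
    S.map (X.castIso h).hom ≫ (X.iso n).hom = (X.iso m).hom ≫ (X.castIso h').hom := by
  subst h
  simp

theorem app_castIso {X Y : OrbitSequence S} (f : X ⟶ Y) {m n : ℤ} (h : m = n) :
    Hom.app f m ≫ (Y.castIso h).hom = (X.castIso h).hom ≫ Hom.app f n := by
  subst h
  simp

variable (S)

/-- Reindexing of sequences. -/
abbrev shift (a : ℤ) : OrbitSequence S ⥤ OrbitSequence S where
  obj X := ⟨fun n => X.obj (n + a), fun n => X.iso (n + a) ≪≫ X.castIso (by lia)⟩
  map f := ⟨fun n => Hom.app f (n + a), fun n => by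
    dsimp
    rw [← Category.assoc, f.comm, Category.assoc, Category.assoc, app_castIso]⟩

theorem shift_castIso (X : OrbitSequence S) (a : ℤ) {m n : ℤ} (h : m = n)
    (h' : m + a = n + a) : ((shift S a).obj X).castIso h = X.castIso h' := rfl

theorem eqToHom_app (X : OrbitSequence S) {a b : ℤ} (h : a = b)
    (p : (shift S a).obj X = (shift S b).obj X) (n : ℤ) (hn : n + a = n + b) :
    Hom.app (eqToHom p) n = (X.castIso hn).hom := by
  subst h
  rfl

/-- On sequences the shift is reindexing, so every coherence is an equality between transports along
equalities of integers, settled by `castIso_trans`. -/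
instance : HasShift (OrbitSequence S) ℤ :=
  hasShiftMk _ _
    { F := shift S
      zero := NatIso.ofComponents
        (fun X => isoMk (fun n => X.castIso (add_zero n)) (fun n => by
          dsimp
          rw [Category.assoc, castIso_trans, iso_castIso]))
        (fun f => by ext n; exact app_castIso f (add_zero n))
      add := fun a b => NatIso.ofComponents
        (fun X => isoMk (fun n => X.castIso (show n + (a + b) = n + b + a by lia)) (fun n => by
          dsimp
          rw [shift_castIso S X a _ (by lia), Category.assoc, Category.assoc, castIso_trans,
            castIso_trans, ← Category.assoc,
            X.iso_castIso (show n + (a + b) = n + b + a by lia) (by lia), Category.assoc,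
            castIso_trans]))
        (fun f => by
          ext n
          exact app_castIso f (show n + (a + b) = n + b + a by lia))
      assoc_hom_app := fun a b c X => by
        ext n
        dsimp
        rw [eqToHom_app S X (add_assoc a b c) _ _ (by lia)]
        change (X.castIso (show n + (a + b + c) = n + c + (a + b) by lia)).hom ≫
          (X.castIso (show n + c + (a + b) = n + c + b + a by lia)).hom = _ ≫
          (X.castIso (show n + (a + (b + c)) = n + (b + c) + a by lia)).hom ≫
          (X.castIso (show n + (b + c) + a = n + c + b + a by lia)).hom
        simp only [castIso_trans]
      zero_add_hom_app := fun a X => by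
        ext n
        dsimp
        rw [eqToHom_app S X (zero_add a) _ _ (by lia)]
        change (X.castIso (show n + (0 + a) = n + a + 0 by lia)).hom = _ ≫
          (X.castIso (show n + a = n + a + 0 by lia)).hom
        simp only [castIso_trans]
      add_zero_hom_app := fun a X => by
        ext n
        dsimp
        rw [eqToHom_app S X (add_zero a) _ _ (by lia)]
        change (X.castIso (show n + (a + 0) = n + 0 + a by lia)).hom = _ ≫
          (X.castIso (show n + a = n + 0 + a by lia)).hom
        simp only [castIso_trans] }

/-- The term of index `0`. -/
@[simps]
def zeroTerm : OrbitSequence S ⥤ P where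
  obj X := X.obj 0
  map f := Hom.app f 0

/-- Compatibility with the structure isomorphisms determines each component from its predecessor,
and from its successor because S is faithful. -/
instance [S.Faithful] : (zeroTerm S).Faithful where
  map_injective {X Y f g} h := by
    have up : ∀ n, Hom.app f n = Hom.app g n → Hom.app f (n + 1) = Hom.app g (n + 1) :=
      fun n hn => by
        rw [← cancel_epi (X.iso n).hom, ← Hom.comm, ← Hom.comm, hn]
    have down : ∀ n, Hom.app f (n + 1) = Hom.app g (n + 1) → Hom.app f n = Hom.app g n :=
      fun n hn => S.map_injective (by
        rw [← cancel_mono (Y.iso n).hom, Hom.comm, Hom.comm, hn])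
    ext n
    induction n using Int.induction_on with
    | zero => exact h
    | succ n hn => exact up _ hn
    | pred n hn => exact down _ (by rwa [sub_add_cancel])

section

variable {S} [S.Full] [S.Faithful] {X Y : OrbitSequence S} (f : X.obj 0 ⟶ Y.obj 0)

/-- The components of nonnegative index of the extension of a morphism of zeroth terms. -/
noncomputable def extendNonneg : ∀ n : ℕ, X.obj (Int.ofNat n) ⟶ Y.obj (Int.ofNat n)
  | 0 => f
  | n + 1 => (X.iso (Int.ofNat n)).inv ≫ S.map (extendNonneg n) ≫ (Y.iso (Int.ofNat n)).hom

/-- The components of negative index of the extension of a morphism of zeroth terms. -/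
noncomputable def extendNeg : ∀ n : ℕ, X.obj (Int.negSucc n) ⟶ Y.obj (Int.negSucc n)
  | 0 => S.preimage ((X.iso (Int.negSucc 0)).hom ≫ f ≫ (Y.iso (Int.negSucc 0)).inv)
  | n + 1 => S.preimage ((X.iso (Int.negSucc (n + 1))).hom ≫ extendNeg n ≫
      (Y.iso (Int.negSucc (n + 1))).inv)

/-- The extension of a morphism of zeroth terms to a morphism of sequences. -/
noncomputable def extend : X ⟶ Y where
  app
    | Int.ofNat n => extendNonneg f n
    | Int.negSucc n => extendNeg f n
  comm
    | Int.ofNat n => ((X.iso (Int.ofNat n)).hom_inv_id_assoc _).symm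
    | Int.negSucc 0 => by
      refine (congrArg (· ≫ (Y.iso (Int.negSucc 0)).hom) (S.map_preimage _)).trans ?_
      simp
      rfl
    | Int.negSucc (n + 1) => by
      refine (congrArg (· ≫ (Y.iso (Int.negSucc (n + 1))).hom) (S.map_preimage _)).trans ?_
      simp
      rfl

end

instance [S.Full] [S.Faithful] : (zeroTerm S).Full where
  map_surjective f := ⟨extend f, rfl⟩

section

variable {S} [S.IsEquivalence] (X : P)

/-- The terms of the sequence of iterated images of an object under an equivalence. -/
noncomputable def orbitObj : ℤ → P
  | Int.ofNat n => Nat.rec X (fun _ Y => S.obj Y) n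
  | Int.negSucc n => Nat.rec (S.inv.obj X) (fun _ Y => S.inv.obj Y) n

/-- The sequence of iterated images of an object under an equivalence. -/
noncomputable def orbit : OrbitSequence S where
  obj := orbitObj (S := S) X
  iso
    | Int.ofNat _ => Iso.refl _
    | Int.negSucc 0 => S.asEquivalence.counitIso.app X
    | Int.negSucc (n + 1) => S.asEquivalence.counitIso.app (orbitObj (S := S) X (Int.negSucc n))

end

instance [S.IsEquivalence] : (zeroTerm S).EssSurj where
  mem_essImage X := ⟨orbit X, ⟨Iso.refl _⟩⟩

instance [S.IsEquivalence] : (zeroTerm S).IsEquivalence where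

/-- The shift of the underlying category transported along the functor `zeroTerm`. -/
noncomputable abbrev hasShift [S.IsEquivalence] : HasShift P ℤ :=
  (Functor.FullyFaithful.ofFullyFaithful (zeroTerm S).inv).hasShift
    (fun n => (zeroTerm S).inv ⋙ shiftFunctor (OrbitSequence S) n ⋙ zeroTerm S)
    (fun _ => Functor.associator _ _ _ ≪≫ Functor.isoWhiskerLeft _ (Functor.associator _ _ _ ≪≫
      Functor.isoWhiskerLeft _ (zeroTerm S).asEquivalence.unitIso.symm ≪≫ Functor.rightUnitor _))

/-- The first shift functor is the given equivalence. -/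
theorem nonempty_shiftFunctor_one_iso [S.IsEquivalence] :
    letI := hasShift S
    Nonempty (shiftFunctor P (1 : ℤ) ≅ S) :=
  ⟨NatIso.ofComponents (fun X => (((zeroTerm S).inv.obj X).iso 0).symm ≪≫
    S.mapIso ((zeroTerm S).asEquivalence.counitIso.app X)) (fun {X Y} f => by
      have h₁ := Hom.comm ((zeroTerm S).inv.map f) 0
      let c (X : P) : ((zeroTerm S).inv.obj X).obj 0 ⟶ X := (zeroTerm S).asEquivalence.counit.app X
      have h₂ : Hom.app ((zeroTerm S).inv.map f) 0 ≫ c Y = c X ≫ f :=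
        (zeroTerm S).asEquivalence.counit.naturality f
      have h₃ : Hom.app ((zeroTerm S).inv.map f) (0 + 1) ≫ (((zeroTerm S).inv.obj Y).iso 0).inv ≫
          S.map (c Y) = ((((zeroTerm S).inv.obj X).iso 0).inv ≫ S.map (c X)) ≫ S.map f := by
        rw [← cancel_epi (((zeroTerm S).inv.obj X).iso 0).hom, ← reassoc_of% h₁,
          Iso.hom_inv_id_assoc, Category.assoc, Iso.hom_inv_id_assoc, ← S.map_comp, ← S.map_comp,
          h₂]
      exact h₃)⟩

end OrbitSequence

section

variable [HasShift P ℤ] {S : P ⥤ P} (e : shiftFunctor P (1 : ℤ) ≅ S)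

include e

theorem shiftFunctor_additive [Preadditive P] [S.Additive] (n : ℤ) :
    (shiftFunctor P n).Additive := by
  have h₁ : (shiftFunctor P (1 : ℤ)).Additive := Functor.additive_of_iso e.symm
  have up : ∀ n : ℤ, (shiftFunctor P n).Additive → (shiftFunctor P (n + 1)).Additive :=
    fun n _ => Functor.additive_of_iso (shiftFunctorAdd P n 1).symm
  induction n using Int.induction_on with
  | zero => exact Functor.additive_of_iso (shiftFunctorZero P ℤ).symm
  | succ n hn => exact up _ hn
  | pred n hn =>
    have : (shiftFunctor P (-n - 1 : ℤ) ⋙ shiftFunctor P (1 : ℤ)).Additive :=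
      Functor.additive_of_iso (shiftFunctorAdd' P (-n - 1 : ℤ) 1 (-n) (by lia))
    exact Functor.additive_of_comp_faithful _ (shiftFunctor P (1 : ℤ))

theorem shiftFunctor_linear {k : Type w} [Semiring k] [Preadditive P] [Linear k P] [S.Linear k]
    (n : ℤ) : (shiftFunctor P n).Linear k := by
  have h₁ : (shiftFunctor P (1 : ℤ)).Linear k := Functor.linear_of_iso k e.symm
  induction n using Int.induction_on with
  | zero => exact Functor.linear_of_iso k (shiftFunctorZero P ℤ).symm
  | succ n hn => exact Functor.linear_of_iso k (shiftFunctorAdd P (n : ℤ) 1).symm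
  | pred n hn =>
    have := Functor.linear_of_iso k (shiftFunctorAdd' P (-n - 1 : ℤ) 1 (-n) (by lia))
    refine ⟨fun f r => (shiftFunctor P (1 : ℤ)).map_injective ?_⟩
    exact (Functor.map_smul (shiftFunctor P (-n - 1 : ℤ) ⋙ shiftFunctor P (1 : ℤ)) r f).trans
      (Functor.map_smul (shiftFunctor P (1 : ℤ)) r _).symm

end

end ShiftOfEquivalence

/-! ### Finitely presented functors, kernels and cokernels -/

section FinitelyPresented

variable {k : Type w} [Field k] {P : Type u} [Category.{v} P] [Preadditive P] [Linear k P]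

open Opposite

/-- Every element of the values of `M` is the image of an identity under a morphism from a
representable functor. -/
def EvaluationSurjective (M : Pᵒᵖ ⥤ ModuleCat.{v} k) : Prop :=
  ∀ (Z : P) (m : M.obj (op Z)), ∃ μ : (linearYoneda k P).obj Z ⟶ M,
    (μ.app (op Z)).hom (𝟙 Z : Z ⟶ Z) = m

theorem linearYoneda_app_apply {M : Pᵒᵖ ⥤ ModuleCat.{v} k} {Z : P}
    (μ : (linearYoneda k P).obj Z ⟶ M) {Y : P} (x : Y ⟶ Z) :
    (μ.app (op Y)).hom x = (M.map x.op).hom ((μ.app (op Z)).hom (𝟙 Z : Z ⟶ Z)) := by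
  have := ConcreteCategory.congr_hom (μ.naturality x.op) (𝟙 Z : Z ⟶ Z)
  refine Eq.trans ?_ this
  exact congrArg (μ.app (op Y)).hom (Category.comp_id x).symm

/-- This half of the Yoneda lemma holds for every M. The other half can fail, since functors in the
ambient category need not be linear; hence the condition `EvaluationSurjective`, which finitely
presented functors satisfy. -/
theorem linearYoneda_hom_ext {M : Pᵒᵖ ⥤ ModuleCat.{v} k} {Z : P}
    {μ ν : (linearYoneda k P).obj Z ⟶ M}
    (h : (μ.app (op Z)).hom (𝟙 Z : Z ⟶ Z) = (ν.app (op Z)).hom (𝟙 Z : Z ⟶ Z)) : μ = ν := by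
  ext Y x
  exact (linearYoneda_app_apply μ x).trans ((congrArg _ h).trans (linearYoneda_app_apply ν x).symm)

omit [Preadditive P] [Linear k P] in
theorem exact_evaluation {S : ShortComplex (Pᵒᵖ ⥤ ModuleCat.{v} k)} (hS : S.Exact) (Z : Pᵒᵖ) :
    (S.map ((evaluation _ _).obj Z)).Exact :=
  hS.map _

omit [Preadditive P] [Linear k P] in
theorem exact_of_evaluation {S : ShortComplex (Pᵒᵖ ⥤ ModuleCat.{v} k)}
    (h : ∀ Z : Pᵒᵖ, (S.map ((evaluation _ _).obj Z)).Exact) : S.Exact := by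
  rw [ShortComplex.exact_iff_isZero_homology]
  refine Functor.isZero _ fun Z => ?_
  exact IsZero.of_iso ((ShortComplex.exact_iff_isZero_homology _).1 (h Z))
    (S.mapHomologyIso ((evaluation _ _).obj Z)).symm

theorem EvaluationSurjective.lift_of_epi {M N : Pᵒᵖ ⥤ ModuleCat.{v} k}
    (hM : EvaluationSurjective M) (q : M ⟶ N) [Epi q] {Z : P}
    (n : (linearYoneda k P).obj Z ⟶ N) : ∃ m : (linearYoneda k P).obj Z ⟶ M, m ≫ q = n := by
  have : Epi (q.app (op Z)) := inferInstance
  obtain ⟨m, hm⟩ := (ModuleCat.epi_iff_surjective _).1 this ((n.app (op Z)).hom (𝟙 Z : Z ⟶ Z))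
  obtain ⟨μ, rfl⟩ := hM Z m
  exact ⟨μ, linearYoneda_hom_ext hm⟩

theorem EvaluationSurjective.lift_of_exact {L M N : Pᵒᵖ ⥤ ModuleCat.{v} k}
    (hL : EvaluationSurjective L) {f : L ⟶ M} {g : M ⟶ N} {w : f ≫ g = 0}
    (h : (ShortComplex.mk f g w).Exact) {Z : P} (m : (linearYoneda k P).obj Z ⟶ M)
    (hm : m ≫ g = 0) : ∃ l : (linearYoneda k P).obj Z ⟶ L, l ≫ f = m := by
  have e := (ShortComplex.moduleCat_exact_iff _).1 (exact_evaluation h (op Z))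
  obtain ⟨l, hl⟩ := e ((m.app (op Z)).hom (𝟙 Z : Z ⟶ Z)) (by
    have := ConcreteCategory.congr_hom (NatTrans.congr_app hm (op Z)) (𝟙 Z : Z ⟶ Z)
    exact this)
  obtain ⟨μ, rfl⟩ := hL Z l
  exact ⟨μ, linearYoneda_hom_ext hl⟩

theorem EvaluationSurjective.epi_of_lift {M N : Pᵒᵖ ⥤ ModuleCat.{v} k}
    (hN : EvaluationSurjective N) {q : M ⟶ N}
    (h : ∀ (Z : P) (n : (linearYoneda k P).obj Z ⟶ N), ∃ m, m ≫ q = n) : Epi q := by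
  rw [NatTrans.epi_iff_epi_app]
  rintro ⟨Z⟩
  rw [ModuleCat.epi_iff_surjective]
  intro n
  obtain ⟨ν, rfl⟩ := hN Z n
  obtain ⟨μ, rfl⟩ := h Z ν
  exact ⟨(μ.app (op Z)).hom (𝟙 Z : Z ⟶ Z), rfl⟩

theorem EvaluationSurjective.exact_of_lift {L M N : Pᵒᵖ ⥤ ModuleCat.{v} k}
    (hM : EvaluationSurjective M) {f : L ⟶ M} {g : M ⟶ N} (w : f ≫ g = 0)
    (h : ∀ (Z : P) (m : (linearYoneda k P).obj Z ⟶ M), m ≫ g = 0 → ∃ l, l ≫ f = m) :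
    (ShortComplex.mk f g w).Exact := by
  refine exact_of_evaluation ?_
  rintro ⟨Z⟩
  rw [ShortComplex.moduleCat_exact_iff]
  intro m hm
  obtain ⟨μ, rfl⟩ := hM Z m
  obtain ⟨l, rfl⟩ := h Z μ (linearYoneda_hom_ext hm)
  exact ⟨(l.app (op Z)).hom (𝟙 Z : Z ⟶ Z), rfl⟩

theorem EvaluationSurjective.of_epi {M N : Pᵒᵖ ⥤ ModuleCat.{v} k}
    (hM : EvaluationSurjective M) (q : M ⟶ N) [Epi q] : EvaluationSurjective N := fun Z n => by
  have : Epi (q.app (op Z)) := inferInstance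
  obtain ⟨m, rfl⟩ := (ModuleCat.epi_iff_surjective _).1 this n
  obtain ⟨μ, rfl⟩ := hM Z m
  exact ⟨μ ≫ q, rfl⟩

theorem evaluationSurjective_linearYoneda (X : P) :
    EvaluationSurjective ((linearYoneda k P).obj X) := fun Z (m : Z ⟶ X) =>
  ⟨(linearYoneda k P).map m, Category.id_comp m⟩

theorem EvaluationSurjective.of_kernel {K M N : Pᵒᵖ ⥤ ModuleCat.{v} k}
    (hM : EvaluationSurjective M) (i : K ⟶ M) [Mono i] (g : M ⟶ N) (w : i ≫ g = 0)
    (h : (ShortComplex.mk i g w).Exact) : EvaluationSurjective K := fun Z m => by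
  obtain ⟨μ, hμ⟩ := hM Z ((i.app (op Z)).hom m)
  obtain ⟨κ, hκ⟩ : ∃ κ : (linearYoneda k P).obj Z ⟶ K, κ ≫ i = μ := by
    have hμg : μ ≫ g = 0 := by
      refine linearYoneda_hom_ext ?_
      refine (congrArg (g.app (op Z)).hom hμ).trans ?_
      exact ConcreteCategory.congr_hom (NatTrans.congr_app w (op Z)) m
    exact ⟨h.lift μ hμg, h.lift_f μ hμg⟩
  refine ⟨κ, ?_⟩
  have : Mono (i.app (op Z)) := inferInstance
  apply (ModuleCat.mono_iff_injective _).1 this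
  subst hκ
  exact hμ

instance : (linearYoneda k P).Additive where
  map_add {X Y f g} := by
    ext Z x
    exact Preadditive.comp_add _ _ _ x f g

/-- A finitely presented functor has a presentation which can be tested on representables. -/
theorem finPres_iff (M : Pᵒᵖ ⥤ ModuleCat.{v} k) : finPres k P M ↔ EvaluationSurjective M ∧
    ∃ (X Y : P) (f : X ⟶ Y) (p : (linearYoneda k P).obj Y ⟶ M),
      (linearYoneda k P).map f ≫ p = 0 ∧
      (∀ (Z : P) (x : Z ⟶ Y), (linearYoneda k P).map x ≫ p = 0 → ∃ x' : Z ⟶ X, x' ≫ f = x) ∧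
      ∀ (Z : P) (m : (linearYoneda k P).obj Z ⟶ M),
        ∃ x : Z ⟶ Y, (linearYoneda k P).map x ≫ p = m := by
  constructor
  · rintro ⟨X, Y, f, p, w, e, hp⟩
    refine ⟨(evaluationSurjective_linearYoneda Y).of_epi p, X, Y, f, p, w, fun Z x hx => ?_,
      fun Z m => ?_⟩
    · obtain ⟨x', hx'⟩ := (evaluationSurjective_linearYoneda X).lift_of_exact e _ hx
      obtain ⟨x', rfl⟩ := (linearYoneda k P).map_surjective x'
      exact ⟨x', (linearYoneda k P).map_injective (by rw [Functor.map_comp, hx'])⟩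
    · obtain ⟨x, hx⟩ := (evaluationSurjective_linearYoneda Y).lift_of_epi p m
      obtain ⟨x, rfl⟩ := (linearYoneda k P).map_surjective x
      exact ⟨x, hx⟩
  · rintro ⟨hM, X, Y, f, p, w, h₁, h₂⟩
    refine ⟨X, Y, f, p, w, (evaluationSurjective_linearYoneda Y).exact_of_lift _ fun Z m hm => ?_,
      hM.epi_of_lift fun Z m => ?_⟩
    · obtain ⟨x, rfl⟩ := (linearYoneda k P).map_surjective m
      obtain ⟨x', rfl⟩ := h₁ Z x hm
      exact ⟨(linearYoneda k P).map x', by rw [Functor.map_comp]⟩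
    · obtain ⟨x, rfl⟩ := h₂ Z m
      exact ⟨_, rfl⟩

instance finPres_isClosedUnderIsomorphisms : (finPres k P).IsClosedUnderIsomorphisms where
  of_iso {M N} e := by
    rintro ⟨X, Y, f, p, w, h, hp⟩
    have w' : (linearYoneda k P).map f ≫ p ≫ e.hom = 0 := by rw [reassoc_of% w, zero_comp]
    exact ⟨X, Y, f, p ≫ e.hom, w', ShortComplex.Exact.of_iso h w' (Iso.refl _) (Iso.refl _) e
      (by simp) (by simp), epi_comp _ _⟩

/-- The cokernel is generated by the generators Y' of the target; its relations are those of the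
target together with the images of the generators Y of the source. -/
instance finPres_isClosedUnderCokernels [HasBinaryBiproducts P] :
    (finPres k P).IsClosedUnderCokernels where
  cokernels_le := by
    rintro _ ⟨(φ : _ ⟶ _), c, hc, hM, hN⟩
    have e : (ShortComplex.mk φ c.π c.condition).Exact := ShortComplex.exact_of_g_is_cokernel _
      (IsColimit.ofIsoColimit hc (Cofork.ext (Iso.refl _) (by simp)))
    have : Epi c.π := Cofork.IsColimit.epi hc
    obtain ⟨hM, X, Y, f, p, w, h₁, h₂⟩ := (finPres_iff _).1 hM
    obtain ⟨hN, X', Y', f', p', w', h₁', h₂'⟩ := (finPres_iff _).1 hN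
    obtain ⟨ψ, hψ⟩ := h₂' _ (p ≫ φ)
    refine (finPres_iff _).2 ⟨hN.of_epi c.π, Y ⊞ X', Y', biprod.desc ψ f', p' ≫ c.π, ?_, ?_, ?_⟩
    · rw [biprod.desc_eq, Functor.map_add, Functor.map_comp, Functor.map_comp,
        Preadditive.add_comp, Category.assoc, Category.assoc, reassoc_of% hψ, reassoc_of% w',
        c.condition]
      simp
    · intro Z x hx
      obtain ⟨m, hm⟩ := hM.lift_of_exact e ((linearYoneda k P).map x ≫ p') (by simpa using hx)
      obtain ⟨z, rfl⟩ := h₂ _ m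
      obtain ⟨x', hx'⟩ := h₁' Z (x - z ≫ ψ) (by
        rw [Functor.map_sub, Preadditive.sub_comp, ← hm, Functor.map_comp, Category.assoc,
          Category.assoc, hψ, sub_self])
      exact ⟨biprod.lift z x', by simp [hx']⟩
    · intro Z n
      obtain ⟨m, rfl⟩ := hN.lift_of_epi c.π n
      obtain ⟨x, rfl⟩ := h₂' _ m
      exact ⟨x, by simp⟩

theorem finPres_isClosedUnderKernels [HasBinaryBiproducts P]
    (hP : ∀ {X Y : P} (u : X ⟶ Y), ∃ (K : P) (i : K ⟶ X), i ≫ u = 0 ∧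
      ∀ (Z : P) (x : Z ⟶ X), x ≫ u = 0 → ∃ z : Z ⟶ K, z ≫ i = x) :
    (finPres k P).IsClosedUnderKernels where
  kernels_le := by
    rintro _ ⟨(φ : _ ⟶ _), c, hc, hM, hN⟩
    have e : (ShortComplex.mk c.ι φ c.condition).Exact := ShortComplex.exact_of_f_is_kernel _
      (IsLimit.ofIsoLimit hc (Fork.ext (Iso.refl _) (by simp)))
    have : Mono c.ι := Fork.IsLimit.mono hc
    obtain ⟨hM, X, Y, f, p, w, h₁, h₂⟩ := (finPres_iff _).1 hM
    obtain ⟨hN, X', Y', f', p', w', h₁', h₂'⟩ := (finPres_iff _).1 hN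
    have hK := hM.of_kernel c.ι φ c.condition e
    obtain ⟨ψ, hψ⟩ := h₂' _ (p ≫ φ)
    -- K₁ is a weak pullback of Y ⟶ Y' and X' ⟶ Y', covering the elements of M killed by φ. K₂ is a
    -- weak pullback of K₁ ⟶ Y and X ⟶ Y, covering their relations.
    obtain ⟨K₁, i₁, hi₁, hi₁'⟩ := hP (biprod.desc ψ f')
    obtain ⟨K₂, i₂, hi₂, hi₂'⟩ := hP (biprod.desc (i₁ ≫ biprod.fst) f)
    rw [biprod.desc_eq, Preadditive.comp_add, ← Category.assoc, ← Category.assoc,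
      add_eq_zero_iff_eq_neg] at hi₁ hi₂
    obtain ⟨q, hqι⟩ : ∃ q : (linearYoneda k P).obj K₁ ⟶ c.pt,
        q ≫ c.ι = (linearYoneda k P).map (i₁ ≫ biprod.fst) ≫ p := by
      have hz : ((linearYoneda k P).map (i₁ ≫ biprod.fst) ≫ p) ≫ φ = 0 := by
        rw [Category.assoc, ← hψ, ← Functor.map_comp_assoc, hi₁, Functor.map_neg,
          Functor.map_comp, Preadditive.neg_comp, Category.assoc, w', comp_zero, neg_zero]
      exact ⟨e.lift _ hz, e.lift_f _ hz⟩
    refine (finPres_iff _).2 ⟨hK, K₂, K₁, i₂ ≫ biprod.fst, q, ?_, ?_, ?_⟩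
    · rw [← cancel_mono c.ι, Category.assoc, hqι, ← Functor.map_comp_assoc, ← Category.assoc, hi₂,
        Functor.map_neg, Functor.map_comp, Functor.map_comp, Preadditive.neg_comp, Category.assoc,
        Category.assoc, w]
      simp
    · intro Z x hx
      obtain ⟨x', hx'⟩ := h₁ Z (x ≫ i₁ ≫ biprod.fst) (by
        rw [Functor.map_comp, Category.assoc, ← hqι, reassoc_of% hx, zero_comp])
      obtain ⟨z, hz⟩ := hi₂' Z (biprod.lift x (-x')) (by simp [hx'])
      exact ⟨z, by rw [reassoc_of% hz, biprod.lift_fst]⟩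
    · intro Z m
      obtain ⟨x, hx⟩ := h₂ Z (m ≫ c.ι)
      obtain ⟨x', hx'⟩ := h₁' Z (x ≫ ψ) (by
        rw [Functor.map_comp, Category.assoc, hψ, reassoc_of% hx, c.condition, comp_zero])
      obtain ⟨z, hz⟩ := hi₁' Z (biprod.lift x (-x')) (by simp [hx'])
      refine ⟨z, ?_⟩
      rw [← cancel_mono c.ι, Category.assoc, hqι, ← Functor.map_comp_assoc, reassoc_of% hz,
        biprod.lift_fst, hx]

instance finPres_containsZero [HasZeroObject P] : (finPres k P).ContainsZero where
  exists_zero := ⟨_, (linearYoneda k P).map_isZero (isZero_zero P), finPres_linearYoneda k P _⟩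

theorem finPres_biprod [HasBinaryBiproducts P] {M N : Pᵒᵖ ⥤ ModuleCat.{v} k}
    (hM : finPres k P M) (hN : finPres k P N) : finPres k P (M ⊞ N) := by
  obtain ⟨hM, X, Y, f, p, w, h₁, h₂⟩ := (finPres_iff _).1 hM
  obtain ⟨hN, X', Y', f', p', w', h₁', h₂'⟩ := (finPres_iff _).1 hN
  let F := linearYoneda k P
  let q : F.obj (Y ⊞ Y') ⟶ M ⊞ N := biprod.lift (F.map biprod.fst ≫ p) (F.map biprod.snd ≫ p')
  have hq₁ : ∀ {Z : P} (x : Z ⟶ Y ⊞ Y'), (F.map x ≫ q) ≫ biprod.fst = F.map (x ≫ biprod.fst) ≫ p :=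
    fun x => by simp [q]
  have hq₂ : ∀ {Z : P} (x : Z ⟶ Y ⊞ Y'), (F.map x ≫ q) ≫ biprod.snd = F.map (x ≫ biprod.snd) ≫ p' :=
    fun x => by simp [q]
  refine (finPres_iff _).2 ⟨fun Z m => ?_, X ⊞ X', Y ⊞ Y', biprod.map f f', q, ?_, ?_, ?_⟩
  · obtain ⟨μ, hμ⟩ := hM Z (((biprod.fst : M ⊞ N ⟶ M).app (op Z)).hom m)
    obtain ⟨ν, hν⟩ := hN Z (((biprod.snd : M ⊞ N ⟶ N).app (op Z)).hom m)
    refine ⟨μ ≫ biprod.inl + ν ≫ biprod.inr, ?_⟩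
    have h := ConcreteCategory.congr_hom
      (NatTrans.congr_app (biprod.total : _ = 𝟙 (M ⊞ N)) (op Z)) m
    refine Eq.trans ?_ h
    change ((biprod.inl : M ⟶ M ⊞ N).app (op Z)).hom ((μ.app (op Z)).hom _) +
      ((biprod.inr : N ⟶ M ⊞ N).app (op Z)).hom ((ν.app (op Z)).hom _) = _
    rw [hμ, hν]
    rfl
  · apply biprod.hom_ext
    · rw [hq₁, biprod.map_fst, Functor.map_comp, Category.assoc, w, comp_zero, zero_comp]
    · rw [hq₂, biprod.map_snd, Functor.map_comp, Category.assoc, w', comp_zero, zero_comp]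
  · intro Z x hx
    obtain ⟨a, ha⟩ := h₁ Z (x ≫ biprod.fst) (by rw [← hq₁, hx, zero_comp])
    obtain ⟨b, hb⟩ := h₁' Z (x ≫ biprod.snd) (by rw [← hq₂, hx, zero_comp])
    exact ⟨biprod.lift a b, by apply biprod.hom_ext <;> simp [ha, hb]⟩
  · intro Z m
    obtain ⟨a, ha⟩ := h₂ Z (m ≫ biprod.fst)
    obtain ⟨b, hb⟩ := h₂' Z (m ≫ biprod.snd)
    refine ⟨biprod.lift a b, ?_⟩
    apply biprod.hom_ext
    · rw [hq₁, biprod.lift_fst, ha]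
    · rw [hq₂, biprod.lift_snd, hb]

instance finPres_isClosedUnderBinaryProducts [HasBinaryBiproducts P] :
    (finPres k P).IsClosedUnderBinaryProducts where
  limitsOfShape_le := by
    rintro X ⟨h⟩
    exact (finPres k P).prop_of_iso
      (biprod.isoProd _ _ ≪≫ (HasLimit.isoOfNatIso (diagramIsoPair h.diag)).symm ≪≫
        (limit.isLimit _).conePointUniqueUpToIso h.isLimit)
      (finPres_biprod (h.prop_diag_obj ⟨.left⟩) (h.prop_diag_obj ⟨.right⟩))

instance finPres_isClosedUnderFiniteProducts [HasZeroObject P] [HasBinaryBiproducts P] :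
    (finPres k P).IsClosedUnderFiniteProducts :=
  ObjectProperty.IsClosedUnderFiniteProducts.mk'

end FinitelyPresented

/-! ### Weak kernels from the Frobenius property -/

section Frobenius

variable {k : Type w} [Field k] {P : Type u} [Category.{v} P] [Preadditive P] [Linear k P]
  [HasBinaryBiproducts P]

/-- `P` has weak kernels if `mod P` is a Frobenius category whose objects embed into objects which
are projective in the categorical sense. -/
theorem exists_weakKernel (hFrob : IsFrobenius (modConflation k P))
    (hI : ∀ Q : ModCat k P, ∃ (I : ModCat k P) (_ : Projective I) (a : Q ⟶ I),
      Mono ((modIncl k P).map a)) {Y Y' : P} (u : Y ⟶ Y') :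
    ∃ (K : P) (i : K ⟶ Y), i ≫ u = 0 ∧
      ∀ (Z : P) (x : Z ⟶ Y), x ≫ u = 0 → ∃ z : Z ⟶ K, z ≫ i = x := by
  let F := linearYoneda k P
  let M : ModCat k P := ⟨cokernel (F.map u), (finPres k P).prop_cokernel (F.map u)
    (finPres_linearYoneda k P Y) (finPres_linearYoneda k P Y')⟩
  let p : F.obj Y' ⟶ M.obj := cokernel.π (F.map u)
  have hup : F.map u ≫ p = 0 := cokernel.condition _
  have ep : (ShortComplex.mk _ _ hup).Exact :=
    ShortComplex.exact_of_g_is_cokernel _ (cokernelIsCokernel _)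
  obtain ⟨K, Q, i, q, hiq, hE, hQ⟩ := hFrob.enough_proj M
  have hQM : Epi q.hom := hE.epi_g
  have hKQ : Mono i.hom := hE.mono_f
  have eQ : (ShortComplex.mk i.hom q.hom (congrArg (·.hom) hiq)).Exact := hE.exact
  obtain ⟨rQ, -⟩ := (finPres_iff _).1 Q.property
  obtain ⟨rK, XK, YK, r, pk, hrpk, hXK, hYK⟩ := (finPres_iff _).1 K.property
  -- Q is projective only for conflations, and an epimorphism F W ⟶ Q is not yet known to have a
  -- finitely presented kernel. But Q is also injective for conflations, and Q ⟶ I is an inflation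
  -- because cokernels are finitely presented. So Q is a retract of I, which is projective for all
  -- epimorphisms and hence a retract of a representable.
  obtain ⟨W, s, t, hst⟩ : ∃ (W : P) (s : Q.obj ⟶ F.obj W) (t : F.obj W ⟶ Q.obj), s ≫ t = 𝟙 _ := by
    obtain ⟨I, hI, a, ha⟩ := hI Q
    let C : ModCat k P := ⟨cokernel a.hom, (finPres k P).prop_cokernel a.hom Q.property I.property⟩
    let c : I ⟶ C := (finPres k P).homMk (cokernel.π a.hom)
    have hac : a ≫ c = 0 := by
      ext1
      exact cokernel.condition a.hom
    have hT : modConflation k P (ShortComplex.mk a c hac) :=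
      { exact := ShortComplex.exact_of_g_is_cokernel _ (cokernelIsCokernel a.hom)
        mono_f := ha
        epi_g := inferInstanceAs (Epi (cokernel.π a.hom)) }
    obtain ⟨b, hb⟩ := (hFrob.proj_iff_inj Q).1 hQ _ hT (𝟙 Q)
    obtain ⟨X, W, f, p, -, -, hp⟩ := I.property
    let p' : (modYoneda k P).obj W ⟶ I := (finPres k P).homMk p
    have : Epi p' := (modIncl k P).epi_of_epi_map hp
    have hp' : Projective.factorThru (𝟙 I) p' ≫ p' = 𝟙 I := Projective.factorThru_comp _ _
    refine ⟨W, (a ≫ Projective.factorThru (𝟙 I) p').hom, (p' ≫ b).hom, ?_⟩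
    have : (a ≫ Projective.factorThru (𝟙 I) p') ≫ p' ≫ b = 𝟙 Q := by
      rw [Category.assoc, reassoc_of% hp']
      exact hb
    exact congrArg (·.hom) this
  obtain ⟨a, ha⟩ := rQ.lift_of_epi q.hom p
  obtain ⟨v, hv⟩ := (evaluationSurjective_linearYoneda Y').lift_of_epi p (t ≫ q.hom)
  let b : Q.obj ⟶ F.obj Y' := s ≫ v
  have hb : b ≫ p = q.hom := by rw [Category.assoc, hv, reassoc_of% hst]
  have factor : ∀ {Z : P} (x : Z ⟶ Y'), F.map x ≫ p = 0 → ∃ x' : Z ⟶ Y, x' ≫ u = x := by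
    intro Z x hx
    obtain ⟨x', hx'⟩ := (evaluationSurjective_linearYoneda Y).lift_of_exact ep _ hx
    obtain ⟨x', rfl⟩ := F.map_surjective x'
    exact ⟨x', F.map_injective (by rw [Functor.map_comp]; exact hx')⟩
  obtain ⟨c, hc⟩ := rK.lift_of_exact eQ (F.map u ≫ a) (by rw [Category.assoc, ha, hup])
  obtain ⟨γ, hγ⟩ := hYK _ c
  obtain ⟨d, hd⟩ := F.map_surjective (pk ≫ i.hom ≫ b)
  obtain ⟨g, hg⟩ := F.map_surjective (a ≫ b)
  have hiq' : i.hom ≫ q.hom = 0 := congrArg (·.hom) hiq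
  obtain ⟨δ, hδ⟩ := factor d (by
    rw [hd, Category.assoc, Category.assoc, hb, hiq', comp_zero])
  obtain ⟨ε, hε⟩ := factor (𝟙 Y' - g) (by
    rw [Functor.map_sub, Preadditive.sub_comp, hg, Category.assoc, hb, ha, F.map_id,
      Category.id_comp, sub_self])
  have hug : u ≫ g = γ ≫ d := F.map_injective (by
    rw [Functor.map_comp, Functor.map_comp, hg, hd, reassoc_of% hγ, reassoc_of% hc])
  have hrd : r ≫ d = 0 := F.map_injective (by
    rw [Functor.map_comp, hd, reassoc_of% hrpk, zero_comp, Functor.map_zero])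
  -- From 1 - g = ε ≫ u and u ≫ g = γ ≫ δ ≫ u it follows that 1 - γ ≫ δ - u ≫ ε kills u on the left.
  -- If x ≫ u = 0, then x ≫ γ is a relation z ≫ r of K, and the second component z ≫ r ≫ δ restores
  -- the term x ≫ γ ≫ δ subtracted by the first.
  refine ⟨Y ⊞ XK, biprod.desc (𝟙 Y - γ ≫ δ - u ≫ ε) (r ≫ δ), ?_, fun Z x hx => ?_⟩
  · apply biprod.hom_ext'
    · simp [Preadditive.sub_comp, hδ, hε, hug]
    · simp [hδ, hrd]
  · obtain ⟨z, hz⟩ := hXK Z (x ≫ γ) (by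
      rw [← cancel_mono i.hom, Functor.map_comp, Category.assoc, Category.assoc, reassoc_of% hγ,
        hc, ← Functor.map_comp_assoc, hx, Functor.map_zero, zero_comp, zero_comp])
    refine ⟨biprod.lift x z, ?_⟩
    simp [reassoc_of% hz, reassoc_of% hx]

end Frobenius

/-! ### `mod P` as an abelian Frobenius category -/

section AbelianModCat

variable {k : Type w} [Field k] {P : Type u} [Category.{v} P] [Preadditive P] [Linear k P]

instance : (modYoneda k P).Full :=
  inferInstanceAs ((finPres k P).lift (linearYoneda k P) (finPres_linearYoneda k P)).Full

instance : (modYoneda k P).Faithful :=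
  inferInstanceAs ((finPres k P).lift (linearYoneda k P) (finPres_linearYoneda k P)).Faithful

instance : (modYoneda k P).Additive where
  map_add := (modIncl k P).map_injective (linearYoneda k P).map_add

variable [HasZeroObject P] [HasBinaryBiproducts P] [(finPres k P).IsClosedUnderKernels]

instance : PreservesFiniteLimits (modIncl k P) :=
  have := (finPres k P).preservesKernels_ι
  Functor.preservesFiniteLimits_of_preservesKernels _

instance : PreservesFiniteColimits (modIncl k P) :=
  have := (finPres k P).preservesCokernels_ι
  Functor.preservesFiniteColimits_of_preservesCokernels _

theorem modExactAt_iff {L M N : ModCat k P} (f : L ⟶ M) (g : M ⟶ N) (h : f ≫ g = 0) :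
    ModExactAt k P f g ↔ (ShortComplex.mk f g h).Exact := by
  rw [← ShortComplex.exact_map_iff_of_faithful _ (modIncl k P)]
  exact ⟨fun H => H.2, fun H => ⟨h, H⟩⟩

theorem modConflation_iff (T : ShortComplex (ModCat k P)) : modConflation k P T ↔ T.ShortExact := by
  refine ⟨fun h => ?_, fun h => h.map_of_exact (modIncl k P)⟩
  have := h.mono_f
  have := h.epi_g
  exact { exact := (ShortComplex.exact_map_iff_of_faithful _ (modIncl k P)).1 h.exact
          mono_f := (modIncl k P).mono_of_mono_map ‹_›
          epi_g := (modIncl k P).epi_of_epi_map ‹_› }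

/-- With kernels available in `mod P`, every epimorphism is a deflation, so the relative and
absolute notions agree. -/
theorem isProjFor_modConflation_iff (M : ModCat k P) :
    IsProjFor (modConflation k P) M ↔ Projective M := by
  refine ⟨fun h => ⟨fun {E X} f p _ => ?_⟩, fun _ T hT f => ?_⟩
  · exact h (ShortComplex.mk _ _ (kernel.condition p)) ((modConflation_iff _).2
      { exact := ShortComplex.exact_of_f_is_kernel _ (kernelIsKernel p) }) f
  · have := ((modConflation_iff T).1 hT).epi_g
    exact ⟨Projective.factorThru f T.g, Projective.factorThru_comp _ _⟩

theorem isInjFor_modConflation_iff (M : ModCat k P) :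
    IsInjFor (modConflation k P) M ↔ Injective M := by
  refine ⟨fun h => ⟨fun {X Y} f i _ => ?_⟩, fun _ T hT f => ?_⟩
  · exact h (ShortComplex.mk _ _ (cokernel.condition i)) ((modConflation_iff _).2
      { exact := ShortComplex.exact_of_g_is_cokernel _ (cokernelIsCokernel i) }) f
  · have := ((modConflation_iff T).1 hT).mono_f
    exact ⟨Injective.factorThru f T.f, Injective.comp_factorThru _ _⟩

theorem IsFrobenius.projective_iff_injective (h : IsFrobenius (modConflation k P))
    (M : ModCat k P) : Projective M ↔ Injective M := by
  rw [← isProjFor_modConflation_iff, h.proj_iff_inj, isInjFor_modConflation_iff]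

theorem IsFrobenius.enoughProjectives (h : IsFrobenius (modConflation k P)) :
    EnoughProjectives (ModCat k P) where
  presentation M := by
    obtain ⟨K, Q, i, p, w, hE, hQ⟩ := h.enough_proj M
    exact ⟨{  p := Q
              projective := (isProjFor_modConflation_iff Q).1 hQ
              f := p
              epi := ((modConflation_iff _).1 hE).epi_g }⟩

theorem IsFrobenius.enoughInjectives (h : IsFrobenius (modConflation k P)) :
    EnoughInjectives (ModCat k P) where
  presentation M := by
    obtain ⟨I, C, i, p, w, hE, hI⟩ := h.enough_inj M
    exact ⟨{  J := I
              injective := (isInjFor_modConflation_iff I).1 hI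
              f := i
              mono := ((modConflation_iff _).1 hE).mono_f }⟩

instance (X : P) : Projective ((modYoneda k P).obj X) where
  factors {E M} f p _ := by
    obtain ⟨m, hm⟩ := ((finPres_iff _).1 E.property).1.lift_of_epi ((modIncl k P).map p) f.hom
    exact ⟨(finPres k P).homMk m, (modIncl k P).map_injective hm⟩

/-- A projective is a retract of a representable, and the corresponding idempotent of `P` splits. -/
theorem exists_modYoneda_iso [IsIdempotentComplete P] (Q : ModCat k P) [Projective Q] :
    ∃ X, Nonempty ((modYoneda k P).obj X ≅ Q) := by
  obtain ⟨-, W, f, p, -, -, hp⟩ := Q.property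
  let q : (modYoneda k P).obj W ⟶ Q := (finPres k P).homMk p
  have : Epi q := (modIncl k P).epi_of_epi_map hp
  let s : Q ⟶ (modYoneda k P).obj W := Projective.factorThru (𝟙 Q) q
  have hs : s ≫ q = 𝟙 Q := Projective.factorThru_comp _ _
  obtain ⟨t, ht⟩ := (modYoneda k P).map_surjective (q ≫ s)
  obtain ⟨X, i, r, hir, hri⟩ := IsIdempotentComplete.idempotents_split W t
    ((modYoneda k P).map_injective (by
      rw [Functor.map_comp, ht, Category.assoc, reassoc_of% hs]))
  refine ⟨X, ⟨⟨(modYoneda k P).map i ≫ q, s ≫ (modYoneda k P).map r, ?_, ?_⟩⟩⟩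
  · rw [Category.assoc, ← reassoc_of% ht, ← Functor.map_comp, ← Functor.map_comp, ← hri,
      Category.assoc, hir, Category.comp_id, hir, CategoryTheory.Functor.map_id]
  · rw [Category.assoc, ← Functor.map_comp_assoc, hri, ht, Category.assoc, hs, Category.comp_id,
      hs]

end AbelianModCat

/-! ### The main theorem -/

theorem theorem8p0p1 (k : Type w) [Field k]
    (P : Type u) [Category.{v} P] [Preadditive P] [Linear k P] [HasFiniteBiproducts P]
    [IsIdempotentComplete P]
    -- `mod P` is a Frobenius category
    (hFrob : IsFrobenius (modConflation k P))
    -- a `k`-linear auto-equivalence `S` of `P` and its extension `S'` to an exact functor on `mod P`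
    (S : P ⥤ P) [S.IsEquivalence] [S.Additive] [S.Linear k]
    (S' : ModCat k P ⥤ ModCat k P) (hS' : IsExactFunctor k P S')
    (e : S ⋙ modYoneda k P ≅ modYoneda k P ⋙ S')
    -- exact functors with values in projectives
    (X₀ X₁ X₂ : ModCat k P ⥤ ModCat k P)
    (hX₀ : IsExactFunctor k P X₀) (hX₁ : IsExactFunctor k P X₁) (hX₂ : IsExactFunctor k P X₂)
    (pX₀ : ∀ M, Projective (X₀.obj M)) (pX₁ : ∀ M, Projective (X₁.obj M))
    (pX₂ : ∀ M, Projective (X₂.obj M))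
    -- the exact sequence of functors
    (α : 𝟭 (ModCat k P) ⟶ X₀) (d₀ : X₀ ⟶ X₁) (d₁ : X₁ ⟶ X₂) (β : X₂ ⟶ S')
    (hexact : ∀ M : ModCat k P, IsExactSeq k P (α.app M) (d₀.app M) (d₁.app M) (β.app M)) :
    ∃ (_ : HasShift P ℤ) (_ : ∀ n : ℤ, (shiftFunctor P n).Additive)
      (_ : ∀ n : ℤ, (shiftFunctor P n).Linear k) (_ : Pretriangulated P)
      (σ : shiftFunctor P (1 : ℤ) ≅ S),
      IsTriangulated P ∧
      -- the standard triangles `X⁰M ⟶ X¹M ⟶ X²M ⟶ S X⁰M` are distinguished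
      ∀ (M : ModCat k P) (A B C : P) (a : (modYoneda k P).obj A ≅ X₀.obj M)
        (b : (modYoneda k P).obj B ≅ X₁.obj M) (c : (modYoneda k P).obj C ≅ X₂.obj M)
        (f : A ⟶ B) (g : B ⟶ C) (h : C ⟶ S.obj A),
        (modYoneda k P).map f ≫ b.hom = a.hom ≫ d₀.app M →
        (modYoneda k P).map g ≫ c.hom = b.hom ≫ d₁.app M →
        (modYoneda k P).map h ≫ e.hom.app A ≫ S'.map a.hom =
          c.hom ≫ β.app M ≫ S'.map (α.app M) →
        Triangle.mk f g (h ≫ σ.inv.app A) ∈ distTriang P := by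
  have : HasZeroObject P := hasZeroObject_of_hasInitial_object
  have : HasBinaryBiproducts P := hasBinaryBiproducts_of_finite_biproducts P
  -- This makes `mod P` abelian with exact inclusion. The embedding Q ⟶ X₀Q supplies the absolutely
  -- projective target required for weak kernels.
  have : (finPres k P).IsClosedUnderKernels := finPres_isClosedUnderKernels
    (exists_weakKernel hFrob fun Q => ⟨X₀.obj Q, pX₀ Q, α.app Q, (hexact Q).mono⟩)
  have hA := hFrob.projective_iff_injective
  have := hFrob.enoughProjectives
  have := hFrob.enoughInjectives
  have (X : P) : Injective ((modYoneda k P).obj X) := (hA _).1 inferInstance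
  obtain ⟨_, hS'⟩ := hS'
  obtain ⟨_, -⟩ := hX₀
  obtain ⟨_, -⟩ := hX₁
  obtain ⟨_, -⟩ := hX₂
  have hT : PreservesFiniteLimits S' ∧ PreservesFiniteColimits S' :=
    ((Functor.exact_tfae S').out 0 3).1 fun T hT => (modConflation_iff _).1
      (hS' T ((modConflation_iff T).2 hT))
  obtain ⟨_, _⟩ := hT
  have w₀ (M) := (hexact M).exact₀.1
  have w₁ (M) := (hexact M).exact₁.1
  have w₂ (M) := (hexact M).exact₂.1
  let R : PeriodicResolution S' :=
    { X₀ := X₀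
      X₁ := X₁
      X₂ := X₂
      α := fun M => α.app M
      d₀ := d₀
      d₁ := d₁
      β := β
      α_natural := fun f => α.naturality f
      mono := fun M => (modIncl k P).mono_of_mono_map (hexact M).mono
      epi := fun M => (modIncl k P).epi_of_epi_map (hexact M).epi
      zero₀ := w₀
      zero₁ := w₁
      zero₂ := w₂
      exact₀ := fun M => (modExactAt_iff _ _ (w₀ M)).1 (hexact M).exact₀
      exact₁ := fun M => (modExactAt_iff _ _ (w₁ M)).1 (hexact M).exact₁
      exact₂ := fun M => (modExactAt_iff _ _ (w₂ M)).1 (hexact M).exact₂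
      injective₀ := fun M => (hA _).1 (pX₀ M)
      injective₁ := fun M => (hA _).1 (pX₁ M)
      injective₂ := fun M => (hA _).1 (pX₂ M) }
  obtain ⟨_, ⟨σ⟩⟩ : ∃ _ : HasShift P ℤ, Nonempty (shiftFunctor P (1 : ℤ) ≅ S) :=
    ⟨OrbitSequence.hasShift S, OrbitSequence.nonempty_shiftFunctor_one_iso S⟩
  have hadd := shiftFunctor_additive σ
  let ε : shiftFunctor P (1 : ℤ) ⋙ modYoneda k P ≅ modYoneda k P ⋙ S' :=
    Functor.isoWhiskerRight σ (modYoneda k P) ≪≫ e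
  have hy (Q : ModCat k P) (_ : Projective Q) := exists_modYoneda_iso Q
  refine ⟨inferInstance, hadd, shiftFunctor_linear σ, R.pretriangulated (modYoneda k P) ε hA hy, σ,
    R.isTriangulated (modYoneda k P) ε hA hy, ?_⟩
  intro M A B C a b c f g h hf hg hh
  refine ⟨(PeriodicResolution.StdTriangle.resolution (R := R) M).ofIso a b c hf hg ?_⟩
  refine Eq.trans ?_ hh
  change (((modYoneda k P).map (h ≫ σ.inv.app A)) ≫ (modYoneda k P).map (σ.hom.app A) ≫
    e.hom.app A) ≫ S'.map a.hom = _
  rw [Category.assoc, Category.assoc, ← Functor.map_comp_assoc, Category.assoc,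
    Iso.inv_hom_id_app, Category.comp_id]
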